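/- Let $\mathcal K=(\mathcal V,\mathcal E,\mathcal F)$ be a finite simplicial surface: a finite simplicial complex in which every simplex lies in a triangle and has at most three vertices, and whose geometric realization $|\mathcal K|$ is a two-dimensional topological manifold, possibly with boundary. Assume that $|\mathcal K|$ is simply connected, and let $\mathcal K$ be oriented (a positive cyclic order of the vertices of each face, such that two faces sharing an edge induce opposite directions on it). A map $X\colon\mathcal V\to\mathbb R^3$ is generic if no face has its three vertices on a line. Its edge lengths are $l_e(X)=\|X_a-X_b\|$ for $e=\{a,b\}$. If the edge $e$ is shared by two faces with positive vertex orders $(a,b,c)$ and $(b,a,d)$, its dihedral angle $\theta_e(X)\in\mathbb R/2\pi\mathbb Z$ is the angle of the rotation about the direction $X_b-X_a$ that takes the unit normal of the face $(b,a,d)$ to the unit normal of the face $(a,b,c)$. At boundary edges no dihedral angle is defined. Let $$\mathcal M=\{z=(l,\theta)\in\mathbb R^{2|\mathcal E|} \mid \exists X \text{ generic}:\ l_e=l_e(X)\ \text{for all } e\in\mathcal E,\ \ \theta_e\equiv\theta_e(X)\!\!\pmod{2\pi}\ \text{for all edges } e \text{ shared by two faces}\},$$ so that the entries $\theta_e$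 at boundary edges are unconstrained. For $z=(l,\theta)\in\mathbb R^{2|\mathcal E|}$ let $\mathcal T(z)\in\mathbb R^{3|\mathcal F|}$ collect the three numbers $l_i+l_j-l_k,\ l_j+l_k-l_i,\ l_k+l_i-l_j$ for each face with edges $i,j,k$. Let $\mathcal V_0$ be the set of interior vertices. For $v\in\mathcal V_0$ choose a positively oriented enumeration $e_0,\dots,e_{n_v-1}$, $f_0,\dots,f_{n_v-1}$ of the edges and faces around $v$, where $f_{i+1}$ contains $e_i$ and $e_{i+1}$ (indices modulo $n_v$). Write $\theta_i=\theta_{e_i}$, and let $\gamma_i$ be the interior angle of $f_i$ at $v$ computed from $l$ by the law of cosines, $\gamma=\arccos\frac{a^2+b^2-c^2}{2ab}$, where $a,b$ are the lengths of the edges of the face at $v$ and $c$ is the length of the opposite edge. With the unit quaternions $q_0(\varphi)=\cos\frac\varphi2+\boldsymbol i\sin\frac\varphi2$ and $q_2(\varphi)=\cos\frac\varphi2+\boldsymbol k\sin\frac\varphi2$ set $$P_v(z)=\prod_{i=0}^{n_v-1}q_0(\theta_i)\,q_2(\gamma_{i+1}),\qquad \mathcal Q_v(z)=\mathrm{vec}\,P_v(z)\in\mathbb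 R^3,\qquad \mathcal Q=(\mathcal Q_v)_{v\in\mathcal V_0},$$ where $\mathrm{vec}(a+b\boldsymbol i+c\boldsymbol j+d\boldsymbol k)=(b,c,d)$ and the products are taken in the order of the loop. Let $\mathcal I_v(z)=\prod_{i=0}^{n_v-1}R_0(\theta_i)R_2(\gamma_{i+1})\in SO(3)$ be the corresponding product of the rotations $R_0,R_2$ about the basis vectors numbered $0$ and $2$ of $\mathbb R^3$ (numbered from $0$). Then $$\mathcal M=\{z\in\mathbb R^{2|\mathcal E|}\mid \mathcal T(z)>0 \text{ componentwise},\ \mathcal Q(z)=0\}.$$ Moreover, for all $z\in\mathbb R^{2|\mathcal E|}$ and $v\in\mathcal V_0$, $$\mathcal Q_v(z)=0\iff P_v(z)=\pm1\iff \mathcal I_v(z)=\mathrm{Id}$$ (in these last equivalences, for arbitrary $z$, one uses $x/0=0$ and extends $\arccos$ to $\mathbb R$ as a constant on each side of $[-1,1]$, namely $\pi$ on $(-\infty,-1]$ and $0$ on $[1,\infty)$; where $\mathcal T(z)>0$ nothing needs to be extended). -/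

import Mathlib

/-! ## Simplicial surfaces -/

/-- The geometric realization `|K|` of a finite abstract simplicial complex, in barycentric
coordinates, with the subspace topology of `V → ℝ`. -/
def AbstractSimplicialComplex.realization {V : Type*} [Fintype V]
    (K : AbstractSimplicialComplex V) : Set (V → ℝ) :=
  {x | (∀ v, 0 ≤ x v) ∧ ∑ v, x v = 1 ∧ ∃ s ∈ K.faces, ∀ v, x v ≠ 0 → v ∈ s}

/-- A (finite) simplicial surface with vertex set `V`: a simplicial complex all of whose simplices
lie in triangles, and whose geometric realization is a two-dimensional topological manifold,
possibly with boundary (it is locally homeomorphic to open subsets of the closed half-plane). -/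
structure SimplicialSurface (V : Type*) [Fintype V] extends AbstractSimplicialComplex V where
  exists_triangle : ∀ s ∈ faces, ∃ t ∈ faces, s ⊆ t ∧ t.card = 3
  card_le_three : ∀ s ∈ faces, s.card ≤ 3
  isManifold : Nonempty
    (ChartedSpace (EuclideanHalfSpace 2) toAbstractSimplicialComplex.realization)

namespace SimplicialSurface

/-- The set `E` of edges. -/
def Edge {V : Type*} [Fintype V] (K : SimplicialSurface V) : Type _ :=
  {e : Finset V // e ∈ K.faces ∧ e.card = 2}

/-- The space `ℝ^{2|E|}` of vectors `z = (l, θ)`, with `z.1 = l` and `z.2 = θ`. -/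
abbrev NRIC {V : Type*} [Fintype V] (K : SimplicialSurface V) : Type _ :=
  (K.Edge → ℝ) × (K.Edge → ℝ)

/-- An orientation of a simplicial surface: `pos a b c` says that `a, b, c` are the vertices of a
face, listed in its positive cyclic order. Each face carries exactly one of its two cyclic orders,
and two distinct faces never induce the same direction on a common edge. -/
structure Orientation {V : Type*} [Fintype V] [DecidableEq V] (K : SimplicialSurface V) where
  pos : V → V → V → Prop
  face_of_pos : ∀ {a b c}, pos a b c →
    ({a, b, c} : Finset V) ∈ K.faces ∧ ({a, b, c} : Finset V).card = 3
  rotate : ∀ {a b c}, pos a b c → pos b c a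
  pos_iff : ∀ {a b c}, ({a, b, c} : Finset V) ∈ K.faces → ({a, b, c} : Finset V).card = 3 →
    (pos a b c ↔ ¬ pos b a c)
  coherent : ∀ {a b c d}, pos a b c → pos a b d → c = d

end SimplicialSurface

/-! ## Geometry of triangles in space -/

namespace NRICGeometry

/-- The cross product on Euclidean three-space. -/
noncomputable def cross (x y : EuclideanSpace ℝ (Fin 3)) : EuclideanSpace ℝ (Fin 3) :=
  WithLp.toLp 2 (crossProduct x.ofLp y.ofLp)

/-- The unit normal of the triangle `p q r`, for which `p, q, r` is counterclockwise. -/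
noncomputable def unitNormal (p q r : EuclideanSpace ℝ (Fin 3)) : EuclideanSpace ℝ (Fin 3) :=
  ‖cross (q - p) (r - p)‖⁻¹ • cross (q - p) (r - p)

/-- The dihedral angle, in `(-π, π]`, at the common edge `p q` of the two coherently oriented
triangles `p q r` and `q p s`: the signed angle between their unit normals, namely the angle of the
rotation about the direction `q - p` that takes the normal of `q p s` to the normal of `p q r`.
It vanishes if the two triangles lie flat, and it is unchanged if the roles of the triangles are
exchanged (which also reverses the edge). -/
noncomputable def dihedralAngle (p q r s : EuclideanSpace ℝ (Fin 3)) : ℝ :=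
  Complex.arg
    ⟨inner ℝ (unitNormal q p s) (unitNormal p q r),
      inner ℝ (‖q - p‖⁻¹ • (q - p)) (cross (unitNormal q p s) (unitNormal p q r))⟩

/-- The unit quaternion of the rotation by `φ` about the zeroth basis vector. -/
noncomputable def q₀ (φ : ℝ) : Quaternion ℝ := ⟨Real.cos (φ / 2), Real.sin (φ / 2), 0, 0⟩

/-- The unit quaternion of the rotation by `φ` about the second basis vector (where the basis
vectors are numbered from zero). -/
noncomputable def q₂ (φ : ℝ) : Quaternion ℝ := ⟨Real.cos (φ / 2), 0, 0, Real.sin (φ / 2)⟩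

/-- The vector part of a quaternion. -/
def vec (q : Quaternion ℝ) : Fin 3 → ℝ := ![q.imI, q.imJ, q.imK]

/-- The rotation matrix by `φ` about the zeroth basis vector. -/
noncomputable def R₀ (φ : ℝ) : Matrix (Fin 3) (Fin 3) ℝ :=
  !![1, 0, 0; 0, Real.cos φ, -Real.sin φ; 0, Real.sin φ, Real.cos φ]

/-- The rotation matrix by `φ` about the second basis vector. -/
noncomputable def R₂ (φ : ℝ) : Matrix (Fin 3) (Fin 3) ℝ :=
  !![Real.cos φ, -Real.sin φ, 0; Real.sin φ, Real.cos φ, 0; 0, 0, 1]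

end NRICGeometry

open NRICGeometry

namespace SimplicialSurface

/-- A generic map: no face has its three vertices on a line. -/
def IsGeneric {V : Type*} [Fintype V] (K : SimplicialSurface V)
    (X : V → EuclideanSpace ℝ (Fin 3)) : Prop :=
  ∀ s ∈ K.faces, s.card = 3 → ¬ Collinear ℝ (X '' (s : Set V))

namespace Orientation

/-- The edge `{a, b}` of the face `a b c`. -/
def edge {V : Type*} [Fintype V] [DecidableEq V] {K : SimplicialSurface V} (o : K.Orientation)
    {a b c : V} (h : o.pos a b c) : K.Edge :=
  ⟨{a, b}, by
    obtain ⟨h₁, h₂⟩ := o.face_of_pos h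
    refine ⟨(K.isRelLowerSet_faces h₁).2 (fun x hx => ?_) ⟨a, by simp⟩, ?_⟩
    · simp only [Finset.mem_insert, Finset.mem_singleton] at hx ⊢
      tauto
    · refine Finset.card_pair fun hab => ?_
      subst hab
      have := Finset.card_le_two (a := a) (b := c)
      simp only [Finset.insert_eq_of_mem, Finset.mem_insert_self] at h₂
      omega⟩

/-- `z = (l, θ)` lists the edge lengths and the dihedral angles of `X`. The dihedral angle is
determined modulo `2π`, and it is defined at the edges that lie in two faces; at a boundary edge
there is no dihedral angle, so that the corresponding entry of `θ` is unconstrained. -/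
def IsRealizedBy {V : Type*} [Fintype V] [DecidableEq V] {K : SimplicialSurface V}
    (o : K.Orientation) (z : K.NRIC) (X : V → EuclideanSpace ℝ (Fin 3)) : Prop :=
  (∀ (e : K.Edge) (a b : V), e.1 = {a, b} → z.1 e = dist (X a) (X b)) ∧
  ∀ (a b c d : V) (h : o.pos a b c), o.pos b a d →
    (z.2 (o.edge h) : Real.Angle) = (dihedralAngle (X a) (X b) (X c) (X d) : Real.Angle)

/-- The NRIC manifold `M`: all vectors of edge lengths and dihedral angles of generic discrete
surfaces. -/
def nricManifold {V : Type*} [Fintype V] [DecidableEq V] {K : SimplicialSurface V}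
    (o : K.Orientation) : Set K.NRIC :=
  {z | ∃ X : V → EuclideanSpace ℝ (Fin 3), K.IsGeneric X ∧ o.IsRealizedBy z X}

/-- The linear map `T : ℝ^{2|E|} → ℝ^{3|F|}` of the triangle inequalities. Its components are
indexed by the positively ordered triples of vertices, three for each face. -/
def triangleMap {V : Type*} [Fintype V] [DecidableEq V] {K : SimplicialSurface V}
    (o : K.Orientation) (z : K.NRIC) (t : {t : V × V × V // o.pos t.1 t.2.1 t.2.2}) : ℝ :=
  z.1 (o.edge t.2) + z.1 (o.edge (o.rotate t.2)) - z.1 (o.edge (o.rotate (o.rotate t.2)))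

/-- The interior angle at `v` of the face `v a b`, from the edge lengths by the law of cosines. -/
noncomputable def interiorAngle {V : Type*} [Fintype V] [DecidableEq V] {K : SimplicialSurface V}
    (o : K.Orientation) (z : K.NRIC) {v a b : V} (h : o.pos v a b) : ℝ :=
  let la := z.1 (o.edge h)
  let lab := z.1 (o.edge (o.rotate h))
  let lb := z.1 (o.edge (o.rotate (o.rotate h)))
  Real.arccos ((la ^ 2 + lb ^ 2 - lab ^ 2) / (2 * la * lb))

/-- A positively oriented loop of all the faces around `v`: the edges at `v` are
`e_i = {v, nbr i}`, with indices modulo `n`, and the face `f_{i+1}` has the vertices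
`v, nbr i, nbr (i + 1)`. -/
structure VertexLoop {V : Type*} [Fintype V] [DecidableEq V] {K : SimplicialSurface V}
    (o : K.Orientation) (v : V) where
  n : ℕ
  nbr : Fin n → V
  injective : Function.Injective nbr
  pos : ∀ i, o.pos v (nbr i) (nbr (finRotate n i))
  complete : ∀ a b, o.pos v a b → ∃ i, nbr i = a

/-- The set `V₀` of interior vertices: those which the faces surround in a closed loop. -/
def InteriorVertex {V : Type*} [Fintype V] [DecidableEq V] {K : SimplicialSurface V}
    (o : K.Orientation) : Type _ :=
  {v : V // Nonempty (o.VertexLoop v)}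

namespace VertexLoop

/-- The product of the quaternions `q₀(θ_i) q₂(γ_{i+1})`, in the order of the loop. -/
noncomputable def quatProd {V : Type*} [Fintype V] [DecidableEq V] {K : SimplicialSurface V}
    {o : K.Orientation} {v : V} (L : o.VertexLoop v) (z : K.NRIC) : Quaternion ℝ :=
  (List.ofFn fun i : Fin L.n =>
    q₀ (z.2 (o.edge (L.pos i))) * q₂ (o.interiorAngle z (L.pos i))).prod

/-- The product `I_v` of the transition rotations `R₀(θ_i) R₂(γ_{i+1})`, in the order of the
loop. -/
noncomputable def rotProd {V : Type*} [Fintype V] [DecidableEq V] {K : SimplicialSurface V}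
    {o : K.Orientation} {v : V} (L : o.VertexLoop v) (z : K.NRIC) : Matrix (Fin 3) (Fin 3) ℝ :=
  (List.ofFn fun i : Fin L.n =>
    R₀ (z.2 (o.edge (L.pos i))) * R₂ (o.interiorAngle z (L.pos i))).prod

end VertexLoop

/-- The map `Q = (Q_v) : ℝ^{2|E|} → ℝ^{3|V₀|}` of the quaternion integrability conditions, for a
choice of a loop around each interior vertex (that is, of the face to start with). -/
noncomputable def quatMap {V : Type*} [Fintype V] [DecidableEq V] {K : SimplicialSurface V}
    (o : K.Orientation) (L : ∀ v : o.InteriorVertex, o.VertexLoop v.1) (z : K.NRIC) :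
    o.InteriorVertex → Fin 3 → ℝ :=
  fun v => vec ((L v).quatProd z)

end Orientation

end SimplicialSurface

/-! A generic surface carries an orthonormal frame for every directed edge of a face: the edge
direction, the inward direction in the plane of the face, and the unit normal. Passing to the next
edge of the face turns the frame by the exterior angle about the normal (`IsFrame.rotate`). Crossing
an edge turns it by π about the normal and then by the dihedral angle about the edge. Lengths and
angles thus determine a discrete SO(3) connection. Around an interior vertex the half turns cancel,
and its holonomy is conjugate to I_v. A realization provides globally consistent frames, so I_v =
Id; its nondegenerate faces satisfy the strict triangle inequalities.

Conversely, the triangle inequalities make the connection trivial around faces, since exterior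
angles add up to a full turn. Edge transitions are involutions, and I_v = Id removes the holonomy at
vertices. On a simply connected surface such a flat connection integrates to frames
(`exists_frames`). The edge vectors, of length l and along the zeroth frame vectors, then sum to
zero around each face and cancel across each edge, so a second integration (`exists_potential`, with
values in the translations) yields the vertex positions.

Both integrations rest on `exists_coboundary`: a cocycle defines a covering with discrete fiber,
which has a section over a simply connected base. The manifold hypothesis enters a second time
through `link_connected`: a closed walk around a vertex exhausts its faces, so at a vertex without a
loop there is no closing condition.

The quaternion form follows because the map from unit quaternions to rotations is a homomorphism
with kernel ±1, and ±1 are the unit quaternions with zero vector part. -/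

/-! ### Cocycles on simply connected complexes -/

namespace AbstractSimplicialComplex

variable {V : Type*} [Fintype V]

/-- The points of the realization in the open star of a vertex. -/
def openStar (K : AbstractSimplicialComplex V) (v : V) : Set K.realization := {x | x.1 v ≠ 0}

theorem isOpen_openStar (K : AbstractSimplicialComplex V) (v : V) : IsOpen (K.openStar v) :=
  isOpen_ne_fun ((continuous_apply v).comp continuous_subtype_val) continuous_const

theorem exists_mem_openStar (K : AbstractSimplicialComplex V) (x : K.realization) :
    ∃ v, x ∈ K.openStar v := by
  by_contra! h
  have h1 := x.2.2.1
  rw [Finset.sum_eq_zero fun v _ => not_not.1 (h v)] at h1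
  exact zero_ne_one h1

/-- The point of the edge `u v` with coordinates `1 - t, t`. -/
theorem edgePoint_mem [DecidableEq V] (K : AbstractSimplicialComplex V) {s : Finset V}
    (hs : s ∈ K.faces) {u v : V} (hu : u ∈ s) (hv : v ∈ s) {t : ℝ} (ht : t ∈ Set.Icc (0 : ℝ) 1) :
    (Pi.single u (1 - t) + Pi.single v t : V → ℝ) ∈ K.realization := by
  refine ⟨fun w => ?_, ?_, s, hs, fun w hw => ?_⟩
  · have h1 : (0 : V → ℝ) ≤ Pi.single u (1 - t) := Pi.single_nonneg.2 (by linarith [ht.2])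
    have h2 : (0 : V → ℝ) ≤ Pi.single v t := Pi.single_nonneg.2 ht.1
    exact add_nonneg (h1 w) (h2 w)
  · simp [Finset.sum_add_distrib]
  · by_contra h
    refine hw ?_
    have h1 : w ≠ u := fun e => h (e ▸ hu)
    have h2 : w ≠ v := fun e => h (e ▸ hv)
    simp [h1, h2]

/-- A locally constant function on an open star takes the same value at the vertex and at the
midpoint of any edge at it. -/
theorem eq_of_continuousOn_openStar [DecidableEq V] (K : AbstractSimplicialComplex V)
    {G : Type*} [TopologicalSpace G] [DiscreteTopology G] {f : K.realization → G} {u : V}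
    (hf : ContinuousOn f (K.openStar u)) {s : Finset V} (hs : s ∈ K.faces) {v : V}
    (hu : u ∈ s) (hv : v ∈ s) {x m : K.realization} (hx : x.1 = Pi.single u 1)
    (hm : m.1 = Pi.single u (1 / 2) + Pi.single v (1 / 2)) : f m = f x := by
  let p : Set.Icc (0 : ℝ) (1 / 2) → K.realization := fun t =>
    ⟨_, K.edgePoint_mem hs hu hv (t := t.1) ⟨t.2.1, t.2.2.trans (by norm_num)⟩⟩
  have hp : Continuous p := by
    refine Continuous.subtype_mk ?_ _
    refine Continuous.add ?_ ?_
    · exact (continuous_single u).comp (by fun_prop)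
    · exact (continuous_single v).comp (by fun_prop)
  have hr : IsPreconnected (Set.range p) := by
    have : PreconnectedSpace (Set.Icc (0 : ℝ) (1 / 2)) :=
      isPreconnected_iff_preconnectedSpace.1 isPreconnected_Icc
    exact isPreconnected_range hp
  -- The path stops at the midpoint, so the coordinate at `u` stays at least 1/2.
  have hsub : Set.range p ⊆ K.openStar u := by
    rintro _ ⟨⟨t, h0, h1⟩, rfl⟩
    change (Pi.single u (1 - t) + Pi.single v t : V → ℝ) u ≠ 0
    have h2 : (0 : ℝ) ≤ (Pi.single v t : V → ℝ) u :=
      (Pi.single_nonneg (i := v).2 h0 : (0 : V → ℝ) ≤ _) u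
    rw [Pi.add_apply, Pi.single_eq_same]
    linarith
  refine hr.constant (hf.mono hsub) ⟨⟨1 / 2, by norm_num⟩, Subtype.ext ?_⟩
    ⟨⟨0, by norm_num⟩, Subtype.ext ?_⟩
  · rw [hm]
    change (Pi.single u (1 - 1 / 2) + Pi.single v (1 / 2) : V → ℝ) = _
    norm_num
  · rw [hx]
    change (Pi.single u (1 - 0) + Pi.single v 0 : V → ℝ) = _
    simp

open scoped Classical in
/-- The bundle with discrete fiber `G` over the realization whose transition functions between
the open stars are right translations by a cocycle. -/
noncomputable def cocycleBundle (K : AbstractSimplicialComplex V) {G : Type*} [Group G]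
    [TopologicalSpace G] [DiscreteTopology G] (c : V → V → G)
    (hc : ∀ s ∈ K.faces, ∀ u ∈ s, ∀ v ∈ s, ∀ w ∈ s, c u v * c v w = c u w) :
    FiberBundleCore V K.realization G where
  baseSet := K.openStar
  isOpen_baseSet := K.isOpen_openStar
  indexAt x := (K.exists_mem_openStar x).choose
  mem_baseSet_at x := (K.exists_mem_openStar x).choose_spec
  coordChange i j _ g := g * c i j
  coordChange_self i x hx g := by
    -- The support of a point lies in one face, so the cocycle rule applies to all stars containing
    -- it; the triple `i, i, i` gives `c i i = 1`.
    obtain ⟨s, hs, h⟩ := x.2.2.2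
    simpa using hc s hs i (h i hx) i (h i hx) i (h i hx)
  continuousOn_coordChange i j :=
    (continuous_of_discreteTopology (f := fun g : G => g * c i j)).comp_continuousOn
      continuousOn_snd
  coordChange_comp i j k x hx g := by
    obtain ⟨s, hs, h⟩ := x.2.2.2
    rw [mul_assoc, hc s hs i (h i hx.1.1) j (h j hx.1.2) k (h k hx.2)]

/-- On a simply connected complex, every cocycle on the edges with values in a group is a
coboundary. -/
theorem exists_coboundary (K : AbstractSimplicialComplex V) [SimplyConnectedSpace K.realization]
    [LocallyPathConnectedSpace K.realization] {G : Type*} [Group G] (c : V → V → G)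
    (hc : ∀ s ∈ K.faces, ∀ u ∈ s, ∀ v ∈ s, ∀ w ∈ s, c u v * c v w = c u w) :
    ∃ h : V → G, ∀ s ∈ K.faces, ∀ u ∈ s, ∀ v ∈ s, h v = h u * c u v := by
  classical
  let _ : TopologicalSpace G := ⊥
  have : DiscreteTopology G := ⟨rfl⟩
  let Z := K.cocycleBundle c hc
  have hcov : IsCoveringMap (Bundle.TotalSpace.proj : Bundle.TotalSpace G Z.Fiber → _) :=
    FiberBundle.isCoveringMap
  obtain ⟨x₀⟩ : Nonempty K.realization := inferInstance
  -- Lifting the identity of the base through the covering gives a global section.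
  obtain ⟨σ, ⟨-, hσ⟩, -⟩ := hcov.existsUnique_continuousMap_lifts (ContinuousMap.id _) x₀
    ⟨x₀, (1 : G)⟩ rfl
  have hσ' : ∀ x, (σ x).1 = x := fun x => congrFun hσ x
  let f : V → K.realization → G := fun v x => (Z.localTriv v (σ x)).2
  have hf : ∀ v, ContinuousOn (f v) (K.openStar v) := fun v =>
    continuous_snd.comp_continuousOn ((Z.localTriv v).continuousOn.comp σ.continuous.continuousOn
      fun x hx => by
        rw [Z.mem_localTriv_source, ← Z.baseSet_at, hσ']
        exact hx)
  have hvert : ∀ v, ∃ x : K.realization, x.1 = Pi.single v 1 := fun v =>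
    ⟨⟨_, K.edgePoint_mem (K.singleton_mem v) (Finset.mem_singleton_self v)
      (Finset.mem_singleton_self v) ⟨le_rfl, zero_le_one⟩⟩, by simp⟩
  choose δ hδ using hvert
  refine ⟨fun v => f v (δ v), fun s hs u hu v hv => ?_⟩
  let m : K.realization := ⟨_, K.edgePoint_mem hs hu hv (t := 1 / 2) (by norm_num)⟩
  have hm : m.1 = Pi.single u (1 / 2) + Pi.single v (1 / 2) := by
    change (Pi.single u (1 - 1 / 2) + Pi.single v (1 / 2) : V → ℝ) = _
    norm_num
  have h1 := K.eq_of_continuousOn_openStar (hf u) hs hu hv (hδ u) hm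
  have h2 := K.eq_of_continuousOn_openStar (hf v) hs hv hu (hδ v) (hm.trans (add_comm _ _))
  change f v (δ v) = f u (δ u) * c u v
  rw [← h1, ← h2]
  have hmu : (σ m).1 ∈ K.openStar u := by
    rw [hσ']
    change m.1 u ≠ 0
    rw [hm]
    by_cases h : u = v <;> simp [h]
  have hmv : (σ m).1 ∈ K.openStar v := by
    rw [hσ']
    change m.1 v ≠ 0
    rw [hm]
    by_cases h : v = u <;> simp [h]
  -- The charts over the stars of `u` and `v` both contain the midpoint `m`, where their readings of
  -- the section differ by `c u v`.
  exact (Z.coordChange_comp _ _ _ _ ⟨⟨Z.mem_baseSet_at _, hmu⟩, hmv⟩ _).symm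

end AbstractSimplicialComplex

/-! ### Connectedness of vertex links -/

/-- A small punctured disc in the plane is connected. -/
theorem isPreconnected_ball_diff_singleton {E : Type*} [NormedAddCommGroup E] [NormedSpace ℝ E]
    (hE : 1 < Module.rank ℝ E) (p : E) (r : ℝ) : IsPreconnected (Metric.ball p r \ {p}) := by
  -- Polar coordinates: the image of an interval times the unit sphere, which is connected in
  -- dimension above one.
  have h : Metric.ball p r \ {p} =
      (fun x : ℝ × E => p + x.1 • x.2) '' (Set.Ioo 0 r ×ˢ Metric.sphere 0 1) := by
    ext y
    constructor
    · rintro ⟨hy, hyp⟩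
      have h0 : 0 < ‖y - p‖ := norm_pos_iff.2 (sub_ne_zero.2 hyp)
      refine ⟨(‖y - p‖, ‖y - p‖⁻¹ • (y - p)), ⟨⟨h0, mem_ball_iff_norm.1 hy⟩, ?_⟩, ?_⟩
      · simp [norm_smul, h0.ne']
      · simp [smul_smul, h0.ne']
    · rintro ⟨⟨t, u⟩, ⟨⟨h0, hr⟩, hu⟩, rfl⟩
      have hu1 : ‖u‖ = 1 := by simpa using hu
      dsimp only at h0 hr
      refine ⟨by simpa [norm_smul, hu1, abs_of_pos h0] using hr, fun h => ?_⟩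
      have h1 : t • u = 0 := by simpa using h
      have h2 := congrArg norm h1
      rw [norm_smul, hu1, norm_zero, mul_one, Real.norm_eq_abs] at h2
      exact h0.ne' (abs_eq_zero.1 h2)
  rw [h]
  exact (isPreconnected_Ioo.prod (isPreconnected_sphere hE 0 1)).image _
    (by fun_prop)

/-- Every point of the closed half-plane has a small neighbourhood in which some connected set
that misses the point is dense. -/
theorem EuclideanHalfSpace.exists_isPreconnected (p : EuclideanHalfSpace 2)
    {U : Set (EuclideanHalfSpace 2)} (hU : U ∈ nhds p) :
    ∃ S W : Set (EuclideanHalfSpace 2), IsPreconnected S ∧ S ⊆ U ∧ p ∉ S ∧ W ∈ nhds p ∧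
      ∀ O ⊆ W, IsOpen O → O.Nonempty → (O ∩ S).Nonempty := by
  have hind : Topology.IsInducing (Subtype.val : EuclideanHalfSpace 2 → _) :=
    Topology.IsInducing.subtypeVal
  obtain ⟨U', hU', hUU⟩ := (hind.nhds_eq_comap p ▸ hU : U ∈ Filter.comap _ _)
  obtain ⟨ε, hε, hball⟩ := Metric.mem_nhds_iff.1 hU'
  -- This covers both cases: `T` is a punctured disc at an interior point, and a convex open
  -- half-disc at a boundary point.
  have hmain : ∀ r : ℝ, 0 < r → r ≤ ε → ∀ T : Set (EuclideanSpace ℝ (Fin 2)), IsPreconnected T →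
      T ⊆ {y | 0 ≤ y 0} → T = (Metric.ball p.1 r ∩ {y | 0 < y 0}) \ {p.1} →
      ∃ S W : Set (EuclideanHalfSpace 2), IsPreconnected S ∧ S ⊆ U ∧ p ∉ S ∧ W ∈ nhds p ∧
      ∀ O ⊆ W, IsOpen O → O.Nonempty → (O ∩ S).Nonempty := by
    intro r hr hrε T hT hT0 hTe
    refine ⟨Subtype.val ⁻¹' T, Subtype.val ⁻¹' Metric.ball p.1 r, ?_, ?_, ?_, ?_, ?_⟩
    · rwa [← hind.isPreconnected_image,
        Set.image_preimage_eq_of_subset fun y hy => ⟨⟨y, hT0 hy⟩, rfl⟩]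
    · intro y hy
      rw [hTe] at hy
      exact hUU (hball (Metric.ball_subset_ball hrε hy.1.1))
    · intro h
      rw [hTe] at h
      exact h.2 rfl
    · exact hind.continuous.continuousAt.preimage_mem_nhds (Metric.ball_mem_nhds _ hr)
    · rintro O hOW hO ⟨z, hz⟩
      let e : EuclideanSpace ℝ (Fin 2) := EuclideanSpace.single 0 1
      have he : e 0 = 1 := by simp [e]
      -- For density, `z` is pushed inwards, off the boundary line; small positive `t` also avoids
      -- `p`. The absolute value keeps the path in the half-plane for every real `t`.
      let γ : ℝ → EuclideanHalfSpace 2 := fun t =>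
        ⟨z.1 + |t| • e, by
          have := z.2
          simp only [PiLp.add_apply, PiLp.smul_apply, he, smul_eq_mul, mul_one]
          positivity⟩
      have hγ : Continuous γ := Continuous.subtype_mk (by fun_prop) _
      have hγ0 : γ 0 = z := Subtype.ext (by simp [γ])
      have h1 : ∀ᶠ t in nhdsWithin (0 : ℝ) (Set.Ioi 0), γ t ∈ O :=
        nhdsWithin_le_nhds (hγ.continuousAt.preimage_mem_nhds
          (hO.mem_nhds (by rw [hγ0]; exact hz)))
      have h2 : ∀ᶠ t in nhdsWithin (0 : ℝ) (Set.Ioi 0), (γ t).1 ≠ p.1 := by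
        by_cases hzp : z.1 = p.1
        · filter_upwards [self_mem_nhdsWithin] with t ht h
          have h3 := congrArg (fun y : EuclideanSpace ℝ (Fin 2) => y 0) h
          simp only [γ, hzp, PiLp.add_apply, PiLp.smul_apply, he, smul_eq_mul, mul_one] at h3
          have : 0 < |t| := abs_pos.2 (ne_of_gt ht)
          linarith
        · refine nhdsWithin_le_nhds ((hind.continuous.comp hγ).continuousAt.eventually_ne ?_)
          simpa [hγ0] using hzp
      obtain ⟨t, ⟨h3, h4⟩, ht⟩ := ((h1.and h2).and self_mem_nhdsWithin).exists
      refine ⟨γ t, h3, ?_⟩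
      change (γ t).1 ∈ T
      rw [hTe]
      refine ⟨⟨hOW h3, ?_⟩, h4⟩
      have h5 := z.2
      have h6 : 0 < |t| := abs_pos.2 (ne_of_gt ht)
      change 0 < (z.1 + |t| • e) 0
      simp only [PiLp.add_apply, PiLp.smul_apply, he, smul_eq_mul, mul_one]
      linarith
  have hopen : IsOpen {y : EuclideanSpace ℝ (Fin 2) | 0 < y 0} :=
    isOpen_lt continuous_const (by fun_prop)
  rcases (p.2 : 0 ≤ p.1 0).eq_or_lt with h0 | h0
  · refine hmain ε hε le_rfl (Metric.ball p.1 ε ∩ {y | 0 < y 0}) ?_ ?_ ?_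
    · refine ((convex_ball _ _).inter fun x hx y hy a b ha hb hab => ?_).isPreconnected
      simp only [Set.mem_ofPred_eq, PiLp.add_apply, PiLp.smul_apply, smul_eq_mul] at hx hy ⊢
      rcases ha.eq_or_lt with rfl | ha
      · have : b = 1 := by linarith
        subst this
        linarith
      · nlinarith [mul_pos ha hx, mul_nonneg hb hy.le]
    · exact fun y hy => show 0 ≤ y 0 from le_of_lt (show 0 < y 0 from hy.2)
    · refine (Set.sdiff_singleton_eq_self ?_).symm
      exact fun h => h.2.ne h0
  · obtain ⟨δ, hδ, hδs⟩ := Metric.isOpen_iff.1 hopen p.1 h0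
    have hsub : Metric.ball p.1 (min δ ε) ⊆ {y | 0 < y 0} :=
      (Metric.ball_subset_ball (min_le_left _ _)).trans hδs
    refine hmain (min δ ε) (lt_min hδ hε) (min_le_right _ _) (Metric.ball p.1 (min δ ε) \ {p.1})
      (isPreconnected_ball_diff_singleton
        (Module.one_lt_rank_of_one_lt_finrank (by simp)) _ _) ?_ ?_
    · exact fun y hy => show 0 ≤ y 0 from le_of_lt (show 0 < y 0 from hsub hy.1)
    · rw [Set.inter_eq_left.2 hsub]

/-- Every point of a surface has a small neighbourhood in which some connected set that misses
the point is dense. -/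
theorem exists_isPreconnected_of_chartedSpace {X : Type*} [TopologicalSpace X]
    [ChartedSpace (EuclideanHalfSpace 2) X] (x : X) {U : Set X} (hU : U ∈ nhds x) :
    ∃ S W : Set X, IsPreconnected S ∧ S ⊆ U ∧ x ∉ S ∧ W ∈ nhds x ∧
      ∀ O ⊆ W, IsOpen O → O.Nonempty → (O ∩ S).Nonempty := by
  let e := chartAt (EuclideanHalfSpace 2) x
  have hx : x ∈ e.source := mem_chart_source _ x
  have h1 : e.target ∩ e.symm ⁻¹' U ∈ nhds (e x) :=
    Filter.inter_mem (e.open_target.mem_nhds (e.map_source hx))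
      ((e.continuousAt_symm (e.map_source hx)).preimage_mem_nhds (by rwa [e.left_inv hx]))
  obtain ⟨S, W, hS, hSU, hpS, hW, hSW⟩ := EuclideanHalfSpace.exists_isPreconnected (e x) h1
  refine ⟨e.symm '' S, e.source ∩ e ⁻¹' W, hS.image _ (e.continuousOn_symm.mono fun y hy =>
    (hSU hy).1), ?_, ?_, Filter.inter_mem (e.open_source.mem_nhds hx)
      ((e.continuousAt hx).preimage_mem_nhds hW), ?_⟩
  · rintro _ ⟨y, hy, rfl⟩
    exact (hSU hy).2
  · rintro ⟨y, hy, h⟩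
    rw [← h, e.right_inv (hSU hy).1] at hpS
    exact hpS hy
  · rintro O hOW hO ⟨z, hz⟩
    obtain ⟨_, ⟨y, hy, rfl⟩, hyS⟩ := hSW (e '' O) (by rintro _ ⟨y, hy, rfl⟩; exact (hOW hy).2)
      (e.isOpen_image_of_subset_source hO fun y hy => (hOW hy).1) ⟨_, z, hz, rfl⟩
    exact ⟨y, hy, _, hyS, e.left_inv (hOW hy).1⟩

/-- In a surface, a set of vertices that is closed under adjacency in the link of a vertex `v` and
that contains a vertex of the link contains all of them. -/
theorem AbstractSimplicialComplex.link_connected {V : Type*} [Fintype V]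
    (K : AbstractSimplicialComplex V) [ChartedSpace (EuclideanHalfSpace 2) K.realization]
    (v : V) (C : Set V)
    (hC : ∀ s ∈ K.faces, v ∈ s → ∀ a ∈ s, ∀ b ∈ s, a ≠ v → b ≠ v → a ∈ C → b ∈ C)
    {s : Finset V} (hs : s ∈ K.faces) (hv : v ∈ s) {a : V} (ha : a ∈ s) (hav : a ≠ v) (haC : a ∈ C)
    {t : Finset V} (ht : t ∈ K.faces) (hvt : v ∈ t) {b : V} (hb : b ∈ t) (hbv : b ≠ v) : b ∈ C := by
  classical
  by_contra hbC
  let x : K.realization := ⟨_, K.edgePoint_mem hs hv hv (t := 0) (by norm_num)⟩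
  have hx : x.1 = Pi.single v 1 := by
    change (Pi.single v (1 - 0) + Pi.single v 0 : V → ℝ) = _
    simp
  have hxv : x ∈ K.openStar v := by
    change x.1 v ≠ 0
    simp [hx]
  obtain ⟨S, W, hS, hSU, hxS, hW, hSW⟩ :=
    exists_isPreconnected_of_chartedSpace x ((K.isOpen_openStar v).mem_nhds hxv)
  -- The open sets `O C` and `O Cᶜ` cover the punctured star and both accumulate at `x`, so the
  -- dense connected set `S` meets both and hence their intersection. A point there has its support
  -- in one face, which joins `C` to its complement.
  let O : Set V → Set K.realization := fun D =>
    K.openStar v ∩ ⋃ w ∈ {w | w ∈ D ∧ w ≠ v}, K.openStar w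
  have hO : ∀ D, IsOpen (O D) := fun D =>
    (K.isOpen_openStar v).inter (isOpen_biUnion fun w _ => K.isOpen_openStar w)
  have hmeet : ∀ (D : Set V) (s : Finset V) (a : V), s ∈ K.faces → v ∈ s → a ∈ s → a ≠ v → a ∈ D →
      (S ∩ O D).Nonempty := by
    intro D s a hs hv ha hav haD
    have hp : ∀ t : Set.Icc (0 : ℝ) 1, (Pi.single v (1 - t.1) + Pi.single a t.1 : V → ℝ) ∈
      K.realization := fun t => K.edgePoint_mem hs hv ha t.2
    have hcont : Continuous fun t : Set.Icc (0 : ℝ) 1 => (⟨_, hp t⟩ : K.realization) := by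
      refine Continuous.subtype_mk (Continuous.add ?_ ?_) _
      · exact (continuous_single v).comp (by fun_prop)
      · exact (continuous_single a).comp (by fun_prop)
    have h0 : (⟨_, hp 0⟩ : K.realization) = x := Subtype.ext (by simp [hx])
    have hW' : interior W ∈ nhds x := interior_mem_nhds.2 hW
    have h1 : ∀ᶠ t in nhds (0 : Set.Icc (0 : ℝ) 1), (⟨_, hp t⟩ : K.realization) ∈ interior W :=
      hcont.continuousAt.preimage_mem_nhds (by rw [h0]; exact hW')
    obtain ⟨ε, hε, h2⟩ := Metric.eventually_nhds_iff.1 h1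
    let τ : Set.Icc (0 : ℝ) 1 := ⟨min (ε / 2) (1 / 2), by positivity,
      (min_le_right _ _).trans (by norm_num)⟩
    have hτ0 : 0 < τ.1 := lt_min (by linarith) (by norm_num)
    have hτ1 : τ.1 ≤ 1 / 2 := min_le_right _ _
    have h3 := h2 (y := τ) (by
      rw [Subtype.dist_eq, Real.dist_eq]
      change |τ.1 - 0| < ε
      rw [sub_zero, abs_of_pos hτ0]
      exact (min_le_left _ _).trans_lt (by linarith))
    have h4 : (⟨_, hp τ⟩ : K.realization) ∈ O D := by
      refine ⟨?_, Set.mem_biUnion (show a ∈ {w | w ∈ D ∧ w ≠ v} from ⟨haD, hav⟩) ?_⟩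
      · change (Pi.single v (1 - τ.1) + Pi.single a τ.1 : V → ℝ) v ≠ 0
        simp only [Pi.add_apply, Pi.single_eq_same, Pi.single_eq_of_ne hav.symm]
        linarith
      · change (Pi.single v (1 - τ.1) + Pi.single a τ.1 : V → ℝ) a ≠ 0
        simp only [Pi.add_apply, Pi.single_eq_same, Pi.single_eq_of_ne hav]
        linarith
    obtain ⟨y, ⟨-, hy⟩, hyS⟩ := hSW (interior W ∩ O D) (Set.inter_subset_left.trans interior_subset)
      (isOpen_interior.inter (hO D)) ⟨_, h3, h4⟩
    exact ⟨y, hyS, hy⟩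
  have hcover : S ⊆ O C ∪ O Cᶜ := by
    intro y hy
    have hyv := hSU hy
    have : ∃ w, w ≠ v ∧ y.1 w ≠ 0 := by
      by_contra! h
      refine hxS ?_
      convert hy
      refine Subtype.ext (funext fun w => ?_)
      have hsum := y.2.2.1
      rw [Finset.sum_eq_single v (fun w _ hw => h w hw) (by simp)] at hsum
      rw [hx]
      by_cases hw : w = v
      · subst hw
        simp [hsum]
      · simp [hw, h w hw]
    obtain ⟨w, hw, hyw⟩ := this
    by_cases hwC : w ∈ C
    · exact Or.inl ⟨hyv, Set.mem_biUnion (show w ∈ {w | w ∈ C ∧ w ≠ v} from ⟨hwC, hw⟩) hyw⟩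
    · exact Or.inr ⟨hyv, Set.mem_biUnion (show w ∈ {w | w ∈ Cᶜ ∧ w ≠ v} from ⟨hwC, hw⟩) hyw⟩
  obtain ⟨y, -, ⟨hyv, hy1⟩, ⟨-, hy2⟩⟩ := hS _ _ (hO C) (hO Cᶜ) hcover
    (hmeet C s a hs hv ha hav haC) (hmeet Cᶜ t b ht hvt hb hbv hbC)
  simp only [Set.mem_iUnion] at hy1 hy2
  obtain ⟨w₁, ⟨hw1, hw1v⟩, hyw1⟩ := hy1
  obtain ⟨w₂, ⟨hw2, hw2v⟩, hyw2⟩ := hy2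
  obtain ⟨s', hs', hsupp⟩ := y.2.2.2
  exact hw2 (hC s' hs' (hsupp v hyv) w₁ (hsupp w₁ hyw1) w₂ (hsupp w₂ hyw2) hw1v hw2v hw1)

/-! ### Cyclic products in a group -/

/-- The product of a cyclic sequence of group elements is trivial if and only if they are the
steps of a closed sequence. -/
theorem List.prod_ofFn_eq_one_iff_exists_finRotate {G : Type*} [Group G] {n : ℕ} (f : Fin n → G) :
    (List.ofFn f).prod = 1 ↔ ∃ P : Fin n → G, ∀ i, P (finRotate n i) = P i * f i := by
  have hstep : ∀ i : Fin n, ((List.ofFn f).take (i + 1)).prod =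
      ((List.ofFn f).take i).prod * f i := fun i => by
    rw [List.prod_take_succ _ _ (by simp)]
    simp
  constructor
  · intro h
    -- The sequence of partial products closes up at the last index because the full product is
    -- trivial.
    refine ⟨fun i => ((List.ofFn f).take i).prod, fun i => ?_⟩
    rw [← hstep]
    obtain ⟨k, rfl⟩ : ∃ k, n = k + 1 := ⟨n - 1, by have := i.pos; omega⟩
    rcases eq_or_ne i (Fin.last k) with rfl | hi
    · have h1 : (List.ofFn f).take (Fin.last k + 1) = List.ofFn f :=
        List.take_of_length_le (by simp)
      rw [finRotate_last, h1, h]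
      rfl
    · dsimp only
      rw [coe_finRotate_of_ne_last hi]
  · rintro ⟨P, hP⟩
    obtain rfl | ⟨k, rfl⟩ : n = 0 ∨ ∃ k, n = k + 1 := by
      rcases n with _ | k
      exacts [Or.inl rfl, Or.inr ⟨k, rfl⟩]
    · simp
    have key : ∀ j (hj : j < k + 1), P ⟨j, hj⟩ = P 0 * ((List.ofFn f).take j).prod := by
      intro j
      induction j with
      | zero => intro _; simp
      | succ j ih =>
        intro hj
        have h1 := hP ⟨j, by omega⟩
        rw [finRotate_of_lt (show j < k by omega)] at h1
        rw [h1, ih, hstep ⟨j, by omega⟩, mul_assoc]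
    have h1 := hP (Fin.last k)
    rw [finRotate_last, show Fin.last k = ⟨k, k.lt_succ_self⟩ from rfl, key k, mul_assoc,
      ← hstep ⟨k, k.lt_succ_self⟩] at h1
    have h2 : (List.ofFn f).take (k + 1) = List.ofFn f := List.take_of_length_le (by simp)
    rw [h2] at h1
    exact (mul_eq_left.1 h1.symm)

/-! ### Integration on an oriented surface -/

namespace SimplicialSurface.Orientation

variable {V : Type*} [Fintype V] [DecidableEq V] {K : SimplicialSurface V} (o : K.Orientation)

theorem ne_of_pos {a b c : V} (h : o.pos a b c) : a ≠ b ∧ b ≠ c ∧ a ≠ c := by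
  have h3 := (o.face_of_pos h).2
  refine ⟨?_, ?_, ?_⟩ <;> rintro rfl
  · have := Finset.card_le_two (a := a) (b := c)
    simp_all
  · have := Finset.card_le_two (a := a) (b := b)
    simp_all
  · have := Finset.card_le_two (a := b) (b := a)
    rw [Finset.insert_comm] at h3
    simp_all

theorem pos_or_pos {s : Finset V} (hs : s ∈ K.faces) {a b c : V} (ha : a ∈ s) (hb : b ∈ s)
    (hc : c ∈ s) (hab : a ≠ b) (hbc : b ≠ c) (hac : a ≠ c) : o.pos a b c ∨ o.pos b a c := by
  have h1 : ({a, b, c} : Finset V) ∈ K.faces := by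
    refine (K.isRelLowerSet_faces hs).2 (fun x hx => ?_) ⟨a, by simp⟩
    simp only [Finset.mem_insert, Finset.mem_singleton] at hx
    rcases hx with rfl | rfl | rfl <;> assumption
  have := o.pos_iff h1 (Finset.card_eq_three.2 ⟨a, b, c, hab, hac, hbc, rfl⟩)
  tauto

theorem coherent_last {a b c d : V} (h : o.pos a c d) (h' : o.pos b c d) : a = b :=
  o.coherent (o.rotate h) (o.rotate h')

/-- Every edge lies in a positively ordered face, in one of its two directions. -/
theorem exists_pos {s : Finset V} (hs : s ∈ K.faces) {a b : V} (ha : a ∈ s) (hb : b ∈ s)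
    (hab : a ≠ b) : ∃ c, o.pos a b c ∨ o.pos b a c := by
  obtain ⟨t, ht, hst, h3⟩ := K.exists_triangle s hs
  obtain ⟨c, hc⟩ : ∃ c, c ∈ (t.erase a).erase b := by
    refine Finset.card_pos.1 ?_
    rw [Finset.card_erase_of_mem (Finset.mem_erase.2 ⟨hab.symm, hst hb⟩),
      Finset.card_erase_of_mem (hst ha), h3]
    norm_num
  simp only [Finset.mem_erase] at hc
  exact ⟨c, o.pos_or_pos ht (hst ha) (hst hb) hc.2.2 hab (Ne.symm hc.1) (Ne.symm hc.2.1)⟩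

/-- On a simply connected surface, every cocycle on the directed edges of the faces is a
coboundary. -/
theorem exists_potential (hK : SimplyConnectedSpace K.toAbstractSimplicialComplex.realization)
    {G : Type*} [Group G] (e : V → V → G)
    (h₃ : ∀ {a b c}, o.pos a b c → e a b * e b c * e c a = 1)
    (h₂ : ∀ {a b c d}, o.pos a b c → o.pos b a d → e a b * e b a = 1) :
    ∃ h : V → G, ∀ {a b c}, o.pos a b c → h b = h a * e a b := by
  classical
  obtain ⟨hman⟩ := K.isManifold
  have hloc := ChartedSpace.locallyPathConnectedSpace (EuclideanHalfSpace 2)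
    K.toAbstractSimplicialComplex.realization
  -- A boundary edge is positive in one direction only, and the other receives the inverse; at an
  -- interior edge `h₂` makes the two values inverse already.
  let c : V → V → G := fun a b =>
    if a = b then 1 else if ∃ c, o.pos a b c then e a b else (e b a)⁻¹
  have c_self : ∀ a, c a a = 1 := fun a => if_pos rfl
  have c_pos : ∀ {a b d}, o.pos a b d → c a b = e a b := fun {a b d} h => by
    change (if _ then _ else _) = _
    rw [if_neg (o.ne_of_pos h).1, if_pos ⟨d, h⟩]
  have c_neg : ∀ {a b d}, o.pos a b d → c b a = (e a b)⁻¹ := fun {a b d} h => by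
    change (if _ then _ else _) = _
    rw [if_neg (o.ne_of_pos h).1.symm]
    split_ifs with h'
    · obtain ⟨d', h'⟩ := h'
      exact eq_inv_of_mul_eq_one_right (h₂ h h')
    · rfl
  have hc : ∀ s ∈ K.faces, ∀ u ∈ s, ∀ v ∈ s, ∀ w ∈ s, c u v * c v w = c u w := by
    intro s hs u hu v hv w hw
    by_cases huv : u = v
    · rw [huv, c_self, one_mul]
    by_cases hvw : v = w
    · rw [hvw, c_self, mul_one]
    by_cases huw : u = w
    · subst huw
      rw [c_self]
      obtain ⟨d, h | h⟩ := o.exists_pos hs hu hv huv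
      · rw [c_pos h, c_neg h, mul_inv_cancel]
      · rw [c_pos h, c_neg h, inv_mul_cancel]
    · rcases o.pos_or_pos hs hu hv hw huv hvw huw with h | h
      · rw [c_pos h, c_pos (o.rotate h), c_neg (o.rotate (o.rotate h))]
        exact eq_inv_of_mul_eq_one_left (h₃ h)
      · rw [c_neg h, c_neg (o.rotate (o.rotate h)), c_pos (o.rotate h)]
        rw [← mul_inv_rev, inv_eq_iff_mul_eq_one]
        rw [mul_assoc, ← h₃ (o.rotate (o.rotate h)), mul_assoc]
  obtain ⟨h, hh⟩ := K.toAbstractSimplicialComplex.exists_coboundary c hc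
  refine ⟨h, fun {a b d} hp => ?_⟩
  rw [← c_pos hp]
  exact hh _ (o.face_of_pos hp).1 _ (by simp) _ (by simp)

/-- A closed walk around a vertex gives rise to a loop of all faces around it, since links of
vertices of surfaces are connected. -/
theorem nonempty_vertexLoop {v a : V} (ha : Relation.TransGen (o.pos v) a a) :
    Nonempty (o.VertexLoop v) := by
  classical
  obtain ⟨hman⟩ := K.isManifold
  -- The successor around `v` is unique by coherence; the default value is never taken along the
  -- orbit of `a`.
  let s : V → V := fun b => if h : ∃ c, o.pos v b c then h.choose else b
  have hs : ∀ {b c}, o.pos v b c → s b = c := fun {b c} h => by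
    have h' : ∃ c, o.pos v b c := ⟨c, h⟩
    simp only [s, dif_pos h']
    exact o.coherent h'.choose_spec h
  have hiter : ∀ {b}, Relation.TransGen (o.pos v) a b →
      ∃ n, 0 < n ∧ s^[n] a = b ∧ ∀ i < n, o.pos v (s^[i] a) (s^[i + 1] a) := by
    intro b hb
    induction hb with
    | single h => exact ⟨1, one_pos, hs h, fun i hi => by
        obtain rfl : i = 0 := by omega
        simpa [hs h] using h⟩
    | tail _ h ih =>
      obtain ⟨n, -, h2, h3⟩ := ih
      refine ⟨n + 1, n.succ_pos, by rw [Function.iterate_succ_apply', h2, hs h], fun i hi => ?_⟩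
      rcases Nat.lt_succ_iff_lt_or_eq.1 hi with hi | rfl
      · exact h3 i hi
      · rwa [Function.iterate_succ_apply', h2, hs h]
  obtain ⟨n, hn, hper, hpos⟩ := hiter ha
  have hper' : Function.IsPeriodicPt s n a := hper
  have hall : ∀ i, o.pos v (s^[i] a) (s^[i + 1] a) := fun i => by
    have := hpos (i % n) (Nat.mod_lt _ hn)
    rw [Function.iterate_succ_apply'] at this ⊢
    rwa [hper'.iterate_mod_apply] at this
  let p := Function.minimalPeriod s a
  have hp : 0 < p := hper'.minimalPeriod_pos hn
  have hpp : s^[p] a = a := Function.isPeriodicPt_minimalPeriod s a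
  have hcomplete : ∀ b c, o.pos v b c → ∃ i, s^[i] a = b := by
    intro b c hbc
    -- The orbit is closed under adjacency in the link: forwards by one step, backwards by `p - 1`
    -- steps. Hence it is the whole link.
    have hC : ∀ t ∈ K.faces, v ∈ t → ∀ x ∈ t, ∀ y ∈ t, x ≠ v → y ≠ v →
        x ∈ {x | ∃ i, s^[i] a = x} → y ∈ {x | ∃ i, s^[i] a = x} := by
      rintro t ht hvt x hx y hy hxv hyv ⟨i, rfl⟩
      by_cases hxy : s^[i] a = y
      · exact ⟨i, hxy⟩
      rcases o.pos_or_pos ht hvt hx hy hxv.symm hxy hyv.symm with h | h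
      · exact ⟨i + 1, by rw [Function.iterate_succ_apply', hs h]⟩
      · refine ⟨i + (p - 1), ?_⟩
        have h1 := hall (i + (p - 1))
        rw [show i + (p - 1) + 1 = i + p by omega, Function.iterate_add_apply s i p, hpp] at h1
        exact o.coherent_last (o.rotate h1) (o.rotate (o.rotate h))
    exact K.toAbstractSimplicialComplex.link_connected v {x | ∃ i, s^[i] a = x} hC
      (o.face_of_pos (hall 0)).1 (by simp) (a := a) (by simp) (o.ne_of_pos (hall 0)).1.symm
      ⟨0, rfl⟩ (o.face_of_pos hbc).1 (by simp) (by simp) (o.ne_of_pos hbc).1.symm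
  refine ⟨⟨p, fun i => s^[i] a, fun i j hij => ?_, fun i => ?_, fun b c hbc => ?_⟩⟩
  · exact Fin.ext (Function.iterate_injOn_Iio_minimalPeriod i.2 j.2 hij)
  · convert hall i using 1
    obtain ⟨k, hk⟩ : ∃ k, p = k + 1 := ⟨p - 1, by omega⟩
    clear_value p
    subst hk
    rcases eq_or_ne i (Fin.last k) with rfl | hi
    · simp [hpp]
    · rw [coe_finRotate_of_ne_last hi]
  · obtain ⟨i, hi⟩ := hcomplete b c hbc
    exact ⟨⟨i % p, Nat.mod_lt _ hp⟩, by rw [← hi]; exact Function.iterate_mod_minimalPeriod_eq⟩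

/-- Around a vertex, transitions between consecutive faces integrate to a function on the faces
if they integrate in case the faces close up. -/
theorem exists_local_section (v : V) {G : Type*} [Group G] (m : V → V → G)
    (hm : Nonempty (o.VertexLoop v) → ∃ (L : o.VertexLoop v) (P : Fin L.n → G),
      ∀ i, P (finRotate _ i) = P i * m (L.nbr i) (L.nbr (finRotate _ i))) :
    ∃ Φ : V → G, ∀ {b c d}, o.pos v b c → o.pos v c d → Φ c = Φ b * m b c := by
  classical
  by_cases hL : Nonempty (o.VertexLoop v)
  · obtain ⟨L, P, hP⟩ := hm hL
    refine ⟨Function.extend L.nbr P 1, fun {b c d} hb _ => ?_⟩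
    obtain ⟨i, rfl⟩ := L.complete b c hb
    obtain rfl : c = L.nbr (finRotate _ i) := o.coherent hb (L.pos i)
    rw [L.injective.extend_apply, L.injective.extend_apply, hP]
  -- Without a loop there is no closed walk around `v`, so on finitely many vertices the successor
  -- relation is well-founded, and `Φ` is built by recursion from the unique predecessor.
  · have hwf : WellFounded (o.pos v) := by
      have : Std.Irrefl (Relation.TransGen (o.pos v)) := ⟨fun a ha => hL (o.nonempty_vertexLoop ha)⟩
      exact Subrelation.wf Relation.TransGen.single
        (Finite.wellFounded_of_trans_of_irrefl (Relation.TransGen (o.pos v)))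
    let Φ : V → G := hwf.fix fun c rec =>
      if h : ∃ b, o.pos v b c then rec h.choose h.choose_spec * m h.choose c else 1
    refine ⟨Φ, fun {b c d} hb _ => ?_⟩
    have h : ∃ b, o.pos v b c := ⟨b, hb⟩
    have hch : h.choose = b :=
      o.coherent (o.rotate (o.rotate h.choose_spec)) (o.rotate (o.rotate hb))
    simp only [Φ]
    rw [hwf.fix_eq, dif_pos h]
    change Φ h.choose * m h.choose c = Φ b * m b c
    rw [hch]

/-- Integration of a flat connection on a simply connected surface: if the transitions `ρ` within
the faces and `τ` across the edges have trivial products around faces, edges and vertices, then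
they come from frames `F a b`, one for every directed edge `a b` of a face. -/
theorem exists_frames (hK : SimplyConnectedSpace K.toAbstractSimplicialComplex.realization)
    {G : Type*} [Group G] (ρ : V → V → V → G) (τ : V → V → G)
    (hρ : ∀ {a b c}, o.pos a b c → ρ a b c * ρ b c a * ρ c a b = 1)
    (hτ : ∀ {a b c d}, o.pos a b c → o.pos b a d → τ a b * τ b a = 1)
    (hm : ∀ v, Nonempty (o.VertexLoop v) → ∃ (L : o.VertexLoop v) (P : Fin L.n → G),
      ∀ i, P (finRotate _ i) = P i *
        ((ρ (L.nbr (finRotate _ i)) v (L.nbr i))⁻¹ * τ (L.nbr (finRotate _ i)) v)) :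
    ∃ F : V → V → G, ∀ {a b c}, o.pos a b c → F b c = F a b * ρ a b c ∧
      ∀ {d}, o.pos b a d → F b a = F a b * τ a b := by
  classical
  choose Φ hΦ using fun v => o.exists_local_section v (fun b c => (ρ c v b)⁻¹ * τ c v) (hm v)
  -- `Φ a` integrates the connection around the single vertex `a`. The element `e a b` compares
  -- these local solutions at `a` and `b`; its potential `h` corrects them to the global frames `h a
  -- * Φ a b`.
  let e : V → V → G := fun a b =>
    if h : ∃ c, o.pos a b c then Φ a b * ρ a b h.choose * (Φ b h.choose)⁻¹ else 1
  have he : ∀ {a b c}, o.pos a b c → e a b = Φ a b * ρ a b c * (Φ b c)⁻¹ := fun {a b c} h => by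
    have h' : ∃ c, o.pos a b c := ⟨c, h⟩
    simp only [e, dif_pos h', o.coherent h'.choose_spec h]
  have he₃ : ∀ {a b c}, o.pos a b c → e a b * e b c * e c a = 1 := fun {a b c} hp => by
    rw [he hp, he (o.rotate hp), he (o.rotate (o.rotate hp))]
    calc _ = Φ a b * (ρ a b c * ρ b c a * ρ c a b) * (Φ a b)⁻¹ := by group
      _ = 1 := by rw [hρ hp]; group
  have he₂ : ∀ {a b c d}, o.pos a b c → o.pos b a d → e a b * e b a = 1 :=
    fun {a b c d} hp hq => by
      rw [he hp, he hq, hΦ b (o.rotate hp) hq, hΦ a (o.rotate hq) hp]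
      calc _ = Φ a d * (ρ b a d)⁻¹ * (τ b a * τ a b) * ρ b a d * (Φ a d)⁻¹ := by group
        _ = 1 := by rw [hτ hq hp]; group
  obtain ⟨h, hh⟩ := o.exists_potential hK e he₃ he₂
  have hF : ∀ {a b c}, o.pos a b c → h b * Φ b c = h a * Φ a b * ρ a b c := fun {a b c} hp => by
    rw [hh hp, he hp]
    group
  refine ⟨fun a b => h a * Φ a b, fun {a b c} hp => ⟨hF hp, fun {d} hq => ?_⟩⟩
  dsimp only
  rw [hΦ b (o.rotate hp) hq, ← mul_assoc, hF hp]
  group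

end SimplicialSurface.Orientation

namespace NRICGeometry

open scoped Quaternion

/-! ### Quaternions and rotations -/

/-- The matrix of `x ↦ q x q̄` on the vector parts of quaternions. -/
def quatRotation : Quaternion ℝ →* Matrix (Fin 3) (Fin 3) ℝ where
  toFun q := !![
    q.re ^ 2 + q.imI ^ 2 - q.imJ ^ 2 - q.imK ^ 2, 2 * (q.imI * q.imJ - q.re * q.imK),
      2 * (q.imI * q.imK + q.re * q.imJ);
    2 * (q.imI * q.imJ + q.re * q.imK), q.re ^ 2 - q.imI ^ 2 + q.imJ ^ 2 - q.imK ^ 2,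
      2 * (q.imJ * q.imK - q.re * q.imI);
    2 * (q.imI * q.imK - q.re * q.imJ), 2 * (q.imJ * q.imK + q.re * q.imI),
      q.re ^ 2 - q.imI ^ 2 - q.imJ ^ 2 + q.imK ^ 2]
  map_one' := by
    ext i j
    fin_cases i <;> fin_cases j <;> simp
  map_mul' p q := by
    ext i j
    fin_cases i <;> fin_cases j <;> simp [Matrix.mul_apply, Fin.sum_univ_three] <;> ring

theorem quatRotation_q₀ (φ : ℝ) : quatRotation (q₀ φ) = R₀ φ := by
  have h1 : Real.cos φ = Real.cos (φ / 2) ^ 2 - Real.sin (φ / 2) ^ 2 := by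
    rw [← Real.cos_two_mul']; ring_nf
  have h2 : Real.sin φ = 2 * Real.sin (φ / 2) * Real.cos (φ / 2) := by
    rw [← Real.sin_two_mul]; ring_nf
  ext i j
  fin_cases i <;> fin_cases j <;> simp [quatRotation, q₀, R₀, h1, h2] <;> ring

theorem quatRotation_q₂ (φ : ℝ) : quatRotation (q₂ φ) = R₂ φ := by
  have h1 : Real.cos φ = Real.cos (φ / 2) ^ 2 - Real.sin (φ / 2) ^ 2 := by
    rw [← Real.cos_two_mul']; ring_nf
  have h2 : Real.sin φ = 2 * Real.sin (φ / 2) * Real.cos (φ / 2) := by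
    rw [← Real.sin_two_mul]; ring_nf
  ext i j
  fin_cases i <;> fin_cases j <;> simp [quatRotation, q₂, R₂, h1, h2] <;> ring

theorem vec_eq_zero_iff (q : Quaternion ℝ) : vec q = 0 ↔ q.imI = 0 ∧ q.imJ = 0 ∧ q.imK = 0 := by
  simp [vec, funext_iff, Fin.forall_fin_succ]

theorem vec_eq_zero_iff_eq_one_or {q : Quaternion ℝ} (hq : Quaternion.normSq q = 1) :
    vec q = 0 ↔ q = 1 ∨ q = -1 := by
  rw [Quaternion.normSq_def'] at hq
  rw [vec_eq_zero_iff]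
  constructor
  · rintro ⟨h1, h2, h3⟩
    have h4 : q.re ^ 2 = 1 := by rw [h1, h2, h3] at hq; linarith
    rcases sq_eq_one_iff.1 h4 with h | h
    · exact Or.inl (by ext <;> simp [*])
    · exact Or.inr (by ext <;> simp [*])
  · rintro (rfl | rfl) <;> simp

theorem vec_eq_zero_iff_quatRotation {q : Quaternion ℝ} (hq : Quaternion.normSq q = 1) :
    vec q = 0 ↔ quatRotation q = 1 := by
  constructor
  · intro h
    rcases (vec_eq_zero_iff_eq_one_or hq).1 h with rfl | rfl
    · exact map_one _
    · ext i j
      fin_cases i <;> fin_cases j <;> simp [quatRotation]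
  · intro h
    rw [Quaternion.normSq_def'] at hq
    rw [vec_eq_zero_iff]
    -- Two diagonal entries suffice: subtracted from the unit norm, they give J² + K² = 0 and I² +
    -- K² = 0.
    have h0 : q.re ^ 2 + q.imI ^ 2 - q.imJ ^ 2 - q.imK ^ 2 = 1 := congrFun (congrFun h 0) 0
    have h1 : q.re ^ 2 - q.imI ^ 2 + q.imJ ^ 2 - q.imK ^ 2 = 1 := congrFun (congrFun h 1) 1
    refine ⟨?_, ?_, ?_⟩ <;> refine pow_eq_zero_iff (two_ne_zero) |>.1 ?_ <;>
      nlinarith [sq_nonneg q.imI, sq_nonneg q.imJ, sq_nonneg q.imK]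

theorem normSq_q₀ (φ : ℝ) : Quaternion.normSq (q₀ φ) = 1 :=
  (Quaternion.normSq_def' _).trans (by simp [q₀])

theorem normSq_q₂ (φ : ℝ) : Quaternion.normSq (q₂ φ) = 1 :=
  (Quaternion.normSq_def' _).trans (by simp [q₂])

end NRICGeometry

/-! ### Quaternion and rotation products around a vertex -/

namespace SimplicialSurface.Orientation.VertexLoop

variable {V : Type*} [Fintype V] [DecidableEq V] {K : SimplicialSurface V} {o : K.Orientation}
  {v : V}

theorem normSq_quatProd (L : o.VertexLoop v) (z : K.NRIC) :
    Quaternion.normSq (L.quatProd z) = 1 := by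
  rw [quatProd, map_list_prod]
  refine List.prod_eq_one fun x hx => ?_
  simp only [List.mem_map, List.mem_ofFn, exists_exists_eq_and] at hx
  obtain ⟨i, rfl⟩ := hx
  rw [map_mul, normSq_q₀, normSq_q₂, one_mul]

theorem quatRotation_quatProd (L : o.VertexLoop v) (z : K.NRIC) :
    quatRotation (L.quatProd z) = L.rotProd z := by
  rw [quatProd, map_list_prod, List.map_ofFn, rotProd]
  congr 2
  funext i
  simp [quatRotation_q₀, quatRotation_q₂]

end SimplicialSurface.Orientation.VertexLoop

namespace NRICGeometry

/-! ### Frames -/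

/-- The rotation group, whose elements are regarded as positively oriented orthonormal frames. -/
abbrev SO3 : Type := Matrix.specialOrthogonalGroup (Fin 3) ℝ

/-- The vectors of a frame. -/
noncomputable def SO3.col (A : SO3) (j : Fin 3) : EuclideanSpace ℝ (Fin 3) :=
  WithLp.toLp 2 fun i => A.1 i j

theorem inner_eq_sum (x y : EuclideanSpace ℝ (Fin 3)) :
    inner ℝ x y = x 0 * y 0 + x 1 * y 1 + x 2 * y 2 := by
  simp [PiLp.inner_apply, Fin.sum_univ_three, mul_comm]

theorem cross_apply_zero (x y : EuclideanSpace ℝ (Fin 3)) :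
    cross x y 0 = x 1 * y 2 - x 2 * y 1 := by simp [cross, cross_apply]

theorem cross_apply_one (x y : EuclideanSpace ℝ (Fin 3)) :
    cross x y 1 = x 2 * y 0 - x 0 * y 2 := by simp [cross, cross_apply]

theorem cross_apply_two (x y : EuclideanSpace ℝ (Fin 3)) :
    cross x y 2 = x 0 * y 1 - x 1 * y 0 := by simp [cross, cross_apply]

theorem ext_three {x y : EuclideanSpace ℝ (Fin 3)} (h0 : x 0 = y 0) (h1 : x 1 = y 1)
    (h2 : x 2 = y 2) : x = y := by
  ext i
  fin_cases i <;> assumption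

namespace SO3

theorem ext_col {A B : SO3} (h : ∀ j, A.col j = B.col j) : A = B :=
  Subtype.ext (Matrix.ext fun i j => congrArg (fun x : EuclideanSpace ℝ (Fin 3) => x i) (h j))

theorem col_mul (A B : SO3) (j : Fin 3) :
    (A * B).col j = B.1 0 j • A.col 0 + B.1 1 j • A.col 1 + B.1 2 j • A.col 2 := by
  ext i
  simp [col, Matrix.mul_apply, Fin.sum_univ_three, mul_comm]

theorem inner_col (A : SO3) (i j : Fin 3) :
    inner ℝ (A.col i) (A.col j) = if i = j then 1 else 0 := by
  have h := (Matrix.mem_orthogonalGroup_iff' (Fin 3) ℝ).1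
    (Matrix.mem_specialOrthogonalGroup_iff.1 A.2).1
  have h' := congrFun (congrFun h i) j
  rw [Matrix.one_apply, Matrix.mul_apply, Fin.sum_univ_three] at h'
  rw [← h', inner_eq_sum]
  simp [col]

theorem norm_col (A : SO3) (i : Fin 3) : ‖A.col i‖ = 1 := by
  have h := A.inner_col i i
  rw [real_inner_self_eq_norm_sq, if_pos rfl] at h
  exact (sq_eq_one_iff.1 h).resolve_right (by linarith [norm_nonneg (A.col i)])

theorem adjugate_eq (A : SO3) : A.1.adjugate = A.1.transpose := by
  obtain ⟨h, hdet⟩ := Matrix.mem_specialOrthogonalGroup_iff.1 A.2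
  have h1 : A.1.transpose * A.1 = 1 := (Matrix.mem_orthogonalGroup_iff' (Fin 3) ℝ).1 h
  calc A.1.adjugate = A.1.transpose * A.1 * A.1.adjugate := by rw [h1, one_mul]
    _ = A.1.transpose := by rw [mul_assoc, Matrix.mul_adjugate, hdet, one_smul, mul_one]

/-- The cofactors of a matrix are the coordinates of the cross products of its columns, and for a
rotation the adjugate is the transpose. -/
theorem cross_col (A : SO3) : cross (A.col 0) (A.col 1) = A.col 2 ∧
    cross (A.col 1) (A.col 2) = A.col 0 ∧ cross (A.col 2) (A.col 0) = A.col 1 := by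
  have h : ∀ i j, A.1.adjugate i j = A.1 j i := fun i j => by rw [A.adjugate_eq]; rfl
  simp only [Matrix.adjugate_fin_three] at h
  refine ⟨ext_three ?_ ?_ ?_, ext_three ?_ ?_ ?_, ext_three ?_ ?_ ?_⟩ <;>
    simp only [cross_apply_zero, cross_apply_one, cross_apply_two, col]
  · rw [← h 2 0]; simp; ring
  · rw [← h 2 1]; simp; ring
  · rw [← h 2 2]; simp; ring
  · rw [← h 0 0]; simp; ring
  · rw [← h 0 1]; simp; ring
  · rw [← h 0 2]; simp; ring
  · rw [← h 1 0]; simp; ring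
  · rw [← h 1 1]; simp; ring
  · rw [← h 1 2]; simp; ring

/-- Two orthonormal vectors extend to a frame. -/
theorem exists_col {x y : EuclideanSpace ℝ (Fin 3)} (hx : ‖x‖ = 1) (hy : ‖y‖ = 1)
    (hxy : inner ℝ x y = 0) : ∃ A : SO3, A.col 0 = x ∧ A.col 1 = y := by
  have hx' : inner ℝ x x = 1 := by rw [real_inner_self_eq_norm_sq, hx, one_pow]
  have hy' : inner ℝ y y = 1 := by rw [real_inner_self_eq_norm_sq, hy, one_pow]
  rw [inner_eq_sum] at hx' hy' hxy
  -- Lagrange's identity. It gives both the norm of the third column `x × y` and the determinant.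
  have hdet : (x 1 * y 2 - x 2 * y 1) ^ 2 + (x 2 * y 0 - x 0 * y 2) ^ 2 +
      (x 0 * y 1 - x 1 * y 0) ^ 2 = 1 := by
    linear_combination (y 0 * y 0 + y 1 * y 1 + y 2 * y 2) * hx' + hy' -
      (x 0 * y 0 + x 1 * y 1 + x 2 * y 2) * hxy
  let M : Matrix (Fin 3) (Fin 3) ℝ := !![x 0, y 0, x 1 * y 2 - x 2 * y 1;
    x 1, y 1, x 2 * y 0 - x 0 * y 2; x 2, y 2, x 0 * y 1 - x 1 * y 0]
  have hM : M ∈ Matrix.specialOrthogonalGroup (Fin 3) ℝ := by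
    rw [Matrix.mem_specialOrthogonalGroup_iff, Matrix.mem_orthogonalGroup_iff']
    constructor
    · ext i j
      rw [Matrix.mul_apply, Fin.sum_univ_three]
      fin_cases i <;> fin_cases j <;> simp [M] <;>
        first
          | linear_combination hx'
          | linear_combination hy'
          | linear_combination hxy
          | linear_combination hdet
          | ring
    · rw [Matrix.det_fin_three]
      simp only [M, Matrix.of_apply, Matrix.cons_val]
      linear_combination hdet
  refine ⟨⟨M, hM⟩, ext_three ?_ ?_ ?_, ext_three ?_ ?_ ?_⟩ <;> simp [col, M]

/-- The rotation by `φ` about the zeroth basis vector. -/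
noncomputable def rot₀ (φ : ℝ) : SO3 := ⟨R₀ φ, by
  rw [Matrix.mem_specialOrthogonalGroup_iff, Matrix.mem_orthogonalGroup_iff']
  have h := Real.sin_sq_add_cos_sq φ
  constructor
  · ext i j
    rw [Matrix.mul_apply, Fin.sum_univ_three]
    fin_cases i <;> fin_cases j <;> simp [R₀] <;>
      first | linear_combination h | ring
  · rw [Matrix.det_fin_three]
    simp only [R₀, Matrix.of_apply, Matrix.cons_val]
    linear_combination h⟩

/-- The rotation by `φ` about the second basis vector. -/
noncomputable def rot₂ (φ : ℝ) : SO3 := ⟨R₂ φ, by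
  rw [Matrix.mem_specialOrthogonalGroup_iff, Matrix.mem_orthogonalGroup_iff']
  have h := Real.sin_sq_add_cos_sq φ
  constructor
  · ext i j
    rw [Matrix.mul_apply, Fin.sum_univ_three]
    fin_cases i <;> fin_cases j <;> simp [R₂] <;>
      first | linear_combination h | ring
  · rw [Matrix.det_fin_three]
    simp only [R₂, Matrix.of_apply, Matrix.cons_val]
    linear_combination h⟩

theorem rot₂_mul (φ ψ : ℝ) : rot₂ φ * rot₂ ψ = rot₂ (φ + ψ) := by
  refine Subtype.ext (Matrix.ext fun i j => ?_)
  change (R₂ φ * R₂ ψ) i j = R₂ (φ + ψ) i j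
  fin_cases i <;> fin_cases j <;>
    simp [R₂, Matrix.mul_apply, Fin.sum_univ_three, Real.cos_add, Real.sin_add] <;> ring

theorem rot₂_eq_one {φ : ℝ} (h : Real.cos φ = 1) : rot₂ φ = 1 := by
  have h1 : Real.sin φ = 0 := by
    have := Real.sin_sq_add_cos_sq φ
    rw [h] at this
    exact pow_eq_zero_iff two_ne_zero |>.1 (by linarith)
  refine Subtype.ext (Matrix.ext fun i j => ?_)
  change R₂ φ i j = (1 : Matrix (Fin 3) (Fin 3) ℝ) i j
  fin_cases i <;> fin_cases j <;> simp [R₂, h, h1]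

theorem rot₂_inv (φ : ℝ) : (rot₂ φ)⁻¹ = rot₂ (-φ) := by
  rw [inv_eq_iff_mul_eq_one, rot₂_mul]
  exact rot₂_eq_one (by simp)

theorem rot₀_congr {φ ψ : ℝ} (h : (φ : Real.Angle) = ψ) : rot₀ φ = rot₀ ψ := by
  have h1 : Real.cos φ = Real.cos ψ := by rw [← Real.Angle.cos_coe, h, Real.Angle.cos_coe]
  have h2 : Real.sin φ = Real.sin ψ := by rw [← Real.Angle.sin_coe, h, Real.Angle.sin_coe]
  refine Subtype.ext ?_
  change R₀ φ = R₀ ψ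
  rw [R₀, R₀, h1, h2]

/-- The transition between the frames at the two sides of an edge with dihedral angle `θ`. -/
noncomputable def edgeTransition (θ : ℝ) : SO3 := rot₂ Real.pi * rot₀ θ

/-- Conjugation by the half turn about the normal inverts the rotation about the edge; hence
crossing back uses the same angle. -/
theorem edgeTransition_mul_self (θ : ℝ) : edgeTransition θ * edgeTransition θ = 1 := by
  have h := Real.sin_sq_add_cos_sq θ
  refine Subtype.ext (Matrix.ext fun i j => ?_)
  change (R₂ Real.pi * R₀ θ * (R₂ Real.pi * R₀ θ)) i j = (1 : Matrix (Fin 3) (Fin 3) ℝ) i j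
  fin_cases i <;> fin_cases j <;> simp [R₀, R₂, Matrix.mul_apply, Fin.sum_univ_three] <;>
    first | linear_combination h | ring

theorem col_mul_edgeTransition (A : SO3) (θ : ℝ) : (A * edgeTransition θ).col 0 = -A.col 0 ∧
    (A * edgeTransition θ).col 1 = -Real.cos θ • A.col 1 + Real.sin θ • A.col 2 ∧
    (A * edgeTransition θ).col 2 = Real.sin θ • A.col 1 + Real.cos θ • A.col 2 := by
  have h : (edgeTransition θ).1 = R₂ Real.pi * R₀ θ := rfl
  refine ⟨?_, ?_, ?_⟩ <;> rw [col_mul, h] <;>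
    simp [R₀, R₂, Matrix.mul_apply, Fin.sum_univ_three]

theorem col_mul_rot₂ (A : SO3) (φ : ℝ) :
    (A * rot₂ φ).col 0 = Real.cos φ • A.col 0 + Real.sin φ • A.col 1 ∧
    (A * rot₂ φ).col 1 = -Real.sin φ • A.col 0 + Real.cos φ • A.col 1 ∧
    (A * rot₂ φ).col 2 = A.col 2 := by
  have h : (rot₂ φ).1 = R₂ φ := rfl
  refine ⟨?_, ?_, ?_⟩ <;> rw [col_mul, h] <;> simp [R₂]

/-- A frame is determined by its zeroth and its last vector. -/
theorem ext_of_col {A B : SO3} (h0 : A.col 0 = B.col 0) (h2 : A.col 2 = B.col 2) : A = B := by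
  have h1 : A.col 1 = B.col 1 := by rw [← A.cross_col.2.2, ← B.cross_col.2.2, h0, h2]
  refine ext_col fun j => ?_
  fin_cases j <;> assumption

/-- Any vector is the combination of the vectors of a frame given by the inner products. -/
theorem sum_inner_col (A : SO3) (x : EuclideanSpace ℝ (Fin 3)) :
    x = inner ℝ (A.col 0) x • A.col 0 + inner ℝ (A.col 1) x • A.col 1 +
      inner ℝ (A.col 2) x • A.col 2 := by
  have h := (Matrix.mem_orthogonalGroup_iff (Fin 3) ℝ).1
    (Matrix.mem_specialOrthogonalGroup_iff.1 A.2).1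
  have h' : ∀ i j, A.1 i 0 * A.1 j 0 + A.1 i 1 * A.1 j 1 + A.1 i 2 * A.1 j 2 =
      (1 : Matrix (Fin 3) (Fin 3) ℝ) i j := fun i j => by
    rw [← h, Matrix.mul_apply, Fin.sum_univ_three]
    rfl
  have h'' : ∀ i, (1 : Matrix (Fin 3) (Fin 3) ℝ) i 0 * x 0 +
      (1 : Matrix (Fin 3) (Fin 3) ℝ) i 1 * x 1 + (1 : Matrix (Fin 3) (Fin 3) ℝ) i 2 * x 2 = x i :=
    fun i => by
      have h1 := congrFun (Matrix.one_mulVec x.ofLp) i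
      rwa [Matrix.mulVec, dotProduct, Fin.sum_univ_three] at h1
  ext i
  simp only [inner_eq_sum, col, PiLp.add_apply, PiLp.smul_apply, smul_eq_mul]
  rw [← h'' i, ← h' i 0, ← h' i 1, ← h' i 2]
  ring

/-- Frames with opposite zeroth vectors are related by a transition across an edge. -/
theorem exists_eq_mul_edgeTransition {A B : SO3} (h : B.col 0 = -A.col 0) :
    ∃ φ, B = A * edgeTransition φ := by
  have h0 : inner ℝ (A.col 0) (B.col 2) = 0 := by
    have : inner ℝ (B.col 0) (B.col 2) = 0 := by rw [B.inner_col]; rfl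
    rwa [h, inner_neg_left, neg_eq_zero] at this
  have hexp := A.sum_inner_col (B.col 2)
  rw [h0, zero_smul, zero_add] at hexp
  set s := inner ℝ (A.col 1) (B.col 2)
  set c := inner ℝ (A.col 2) (B.col 2)
  have hn : c ^ 2 + s ^ 2 = 1 := by
    have h1 := B.inner_col 2 2
    rw [if_pos rfl, hexp] at h1
    simp only [inner_add_left, inner_add_right, inner_smul_left, inner_smul_right, A.inner_col]
      at h1
    simp at h1
    linarith
  have habs : ‖(⟨c, s⟩ : ℂ)‖ = 1 := by
    rw [Complex.norm_eq_sqrt_sq_add_sq, hn, Real.sqrt_one]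
  have hne : (⟨c, s⟩ : ℂ) ≠ 0 := norm_pos_iff.1 (by rw [habs]; exact one_pos)
  -- The last vector of `B` is orthogonal to the edge, hence a point of the unit circle in the other
  -- two vectors of `A`; `φ` is its polar angle.
  refine ⟨Complex.arg ⟨c, s⟩, ext_of_col ?_ ?_⟩
  · rw [h, (col_mul_edgeTransition _ _).1]
  · rw [hexp, (col_mul_edgeTransition _ _).2.2, Complex.cos_arg hne, Complex.sin_arg, habs]
    simp

end SO3

end NRICGeometry

namespace NRICGeometry

/-! ### Triangles with prescribed lengths -/

/-- The angle between the sides `x` and `w` of a triangle with third side `y`. -/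
noncomputable def lawAngle (x y w : ℝ) : ℝ := Real.arccos ((x ^ 2 + w ^ 2 - y ^ 2) / (2 * x * w))

/-- Four times the area of the triangle with sides `x, y, w`, by Heron's formula. -/
noncomputable def heron (x y w : ℝ) : ℝ :=
  √((x + y + w) * (x + y - w) * (y + w - x) * (w + x - y))

theorem heron_rotate (x y w : ℝ) : heron y w x = heron x y w := by
  unfold heron
  ring_nf

section

variable {x y w : ℝ} (h1 : 0 < x + y - w) (h2 : 0 < y + w - x) (h3 : 0 < w + x - y)
include h1 h2 h3

theorem heron_pos : 0 < heron x y w :=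
  Real.sqrt_pos.2 (mul_pos (mul_pos (mul_pos (by linarith) h1) h2) h3)

theorem heron_sq : heron x y w ^ 2 = (x + y + w) * (x + y - w) * (y + w - x) * (w + x - y) :=
  Real.sq_sqrt (mul_pos (mul_pos (mul_pos (by linarith) h1) h2) h3).le

theorem cos_lawAngle : Real.cos (lawAngle x y w) = (x ^ 2 + w ^ 2 - y ^ 2) / (2 * x * w) := by
  have hx : 0 < x := by linarith
  have hw : 0 < w := by linarith
  refine Real.cos_arccos ?_ ?_
  · rw [le_div_iff₀ (by positivity)]
    nlinarith [mul_pos (show 0 < x + w + y by linarith) h3]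
  · rw [div_le_one (by positivity)]
    nlinarith [mul_pos h1 h2]

theorem sin_lawAngle : Real.sin (lawAngle x y w) = heron x y w / (2 * x * w) := by
  have hx : 0 < x := by linarith
  have hw : 0 < w := by linarith
  rw [lawAngle, Real.sin_arccos]
  refine Real.sqrt_eq_iff_mul_self_eq_of_pos (div_pos (heron_pos h1 h2 h3) (by positivity)) |>.2 ?_
  rw [← sq, div_pow, heron_sq h1 h2 h3]
  field_simp
  ring

theorem sin_lawAngle_pos : 0 < Real.sin (lawAngle x y w) := by
  rw [sin_lawAngle h1 h2 h3]
  exact div_pos (heron_pos h1 h2 h3)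
    (mul_pos (mul_pos two_pos (show 0 < x by linarith)) (show 0 < w by linarith))

/-- The exterior angles of a triangle add up to a full turn. -/
theorem cos_sum_exterior : Real.cos (Real.pi - lawAngle y w x + (Real.pi - lawAngle w x y) +
    (Real.pi - lawAngle x y w)) = 1 := by
  have hx : 0 < x := by linarith
  have hy : 0 < y := by linarith
  have hw : 0 < w := by linarith
  have hH := heron_sq h1 h2 h3
  -- In the expanded cosine the sines occur in pairs and share the numerator `S`, so only Heron's
  -- formula for `S ^ 2` is needed.
  simp only [Real.cos_add, Real.sin_add, Real.cos_pi_sub, Real.sin_pi_sub]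
  rw [cos_lawAngle h1 h2 h3, cos_lawAngle h2 h3 h1, cos_lawAngle h3 h1 h2, sin_lawAngle h1 h2 h3,
    sin_lawAngle h2 h3 h1, sin_lawAngle h3 h1 h2, heron_rotate y w x, heron_rotate x y w]
  set S := heron x y w
  field_simp
  linear_combination (x ^ 2 + y ^ 2 + w ^ 2) * hH

/-- The triangle closes up: the components along the side `x` cancel, and those orthogonal to it are
the same altitude computed from both ends. -/
theorem side_eq : x - y * Real.cos (lawAngle y w x) - w * Real.cos (lawAngle x y w) = 0 ∧
    y * Real.sin (lawAngle y w x) - w * Real.sin (lawAngle x y w) = 0 := by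
  have hx : 0 < x := by linarith
  have hy : 0 < y := by linarith
  have hw : 0 < w := by linarith
  rw [cos_lawAngle h1 h2 h3, cos_lawAngle h2 h3 h1, sin_lawAngle h1 h2 h3, sin_lawAngle h2 h3 h1,
    heron_rotate]
  constructor
  · field_simp
    ring
  · field_simp
    ring

end

/-! ### Frames of triangles in space -/

/-- The frame `A` of the triangle `p q r` consists of the direction of `q - p`, the direction in the
plane of the triangle orthogonal to it on the side of `r`, and the unit normal. -/
def IsFrame (A : SO3) (p q r : EuclideanSpace ℝ (Fin 3)) : Prop :=
  ∃ x s t : ℝ, 0 < x ∧ 0 < s ∧ q - p = x • A.col 0 ∧ r - p = t • A.col 0 + s • A.col 1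

theorem norm_combination (A : SO3) (t s : ℝ) : ‖t • A.col 0 + s • A.col 1‖ ^ 2 = t ^ 2 + s ^ 2 := by
  rw [← real_inner_self_eq_norm_sq]
  simp only [inner_add_left, inner_add_right, inner_smul_left, inner_smul_right, A.inner_col]
  simp
  ring

theorem cross_combination (A : SO3) (x t s : ℝ) :
    cross (x • A.col 0) (t • A.col 0 + s • A.col 1) = (x * s) • A.col 2 := by
  rw [← A.cross_col.1]
  refine ext_three ?_ ?_ ?_ <;>
    simp only [cross_apply_zero, cross_apply_one, cross_apply_two, PiLp.add_apply, PiLp.smul_apply,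
      smul_eq_mul] <;> ring

theorem exists_isFrame {p q r : EuclideanSpace ℝ (Fin 3)}
    (h : ¬ Collinear ℝ ({p, q, r} : Set (EuclideanSpace ℝ (Fin 3)))) : ∃ A, IsFrame A p q r := by
  have hu : q - p ≠ 0 := fun h0 => h (by
    rw [sub_eq_zero.1 h0, Set.insert_eq_of_mem (by simp)]
    exact collinear_pair ℝ p r)
  have hu0 : 0 < ‖q - p‖ := norm_pos_iff.2 hu
  set u := ‖q - p‖⁻¹ • (q - p) with hudef
  have hun : ‖u‖ = 1 := by rw [hudef, norm_smul, norm_inv, norm_norm, inv_mul_cancel₀ hu0.ne']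
  have hqp : q - p = ‖q - p‖ • u := by rw [hudef, smul_smul, mul_inv_cancel₀ hu0.ne', one_smul]
  -- Gram–Schmidt; a vanishing remainder `w` would put `r` on the line through `p` and `q`.
  set t := inner ℝ u (r - p)
  set w := r - p - t • u with hw
  have hw0 : w ≠ 0 := fun h0 => h (by
    rw [collinear_iff_of_mem (p₀ := p) (by simp)]
    refine ⟨u, ?_⟩
    simp only [Set.mem_insert_iff, Set.mem_singleton_iff, forall_eq_or_imp, forall_eq, vadd_eq_add]
    refine ⟨⟨0, by simp⟩, ⟨‖q - p‖, by rw [← hqp]; simp⟩, ⟨t, ?_⟩⟩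
    rw [← sub_eq_zero.1 (hw ▸ h0 : r - p - t • u = 0)]
    simp)
  have hw1 : 0 < ‖w‖ := norm_pos_iff.2 hw0
  have huw : inner ℝ u w = 0 := by
    rw [hw, inner_sub_right, inner_smul_right, real_inner_self_eq_norm_sq, hun]
    ring
  obtain ⟨A, hA0, hA1⟩ := SO3.exists_col (x := u) (y := ‖w‖⁻¹ • w) hun
    (by rw [norm_smul, norm_inv, norm_norm, inv_mul_cancel₀ hw1.ne'])
    (by rw [inner_smul_right, huw, mul_zero])
  refine ⟨A, ‖q - p‖, ‖w‖, t, hu0, hw1, by rw [hA0, ← hqp], ?_⟩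
  rw [hA0, hA1, smul_smul ‖w‖, mul_inv_cancel₀ hw1.ne', one_smul, hw]
  abel

namespace IsFrame

variable {A : SO3} {p q r : EuclideanSpace ℝ (Fin 3)}

theorem direction_eq (h : IsFrame A p q r) : ‖q - p‖⁻¹ • (q - p) = A.col 0 := by
  obtain ⟨x, s, t, hx, hs, h1, h2⟩ := h
  rw [h1, norm_smul, A.norm_col, Real.norm_of_nonneg hx.le, mul_one, smul_smul,
    inv_mul_cancel₀ hx.ne', one_smul]

theorem unitNormal_eq (h : IsFrame A p q r) : unitNormal p q r = A.col 2 := by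
  obtain ⟨x, s, t, hx, hs, h1, h2⟩ := h
  have hxs := mul_pos hx hs
  rw [unitNormal, h1, h2, cross_combination, norm_smul, A.norm_col, Real.norm_of_nonneg hxs.le,
    mul_one, smul_smul, inv_mul_cancel₀ hxs.ne', one_smul]

protected theorem eq {B : SO3} (h : IsFrame A p q r) (h' : IsFrame B p q r) : A = B :=
  SO3.ext_of_col (by rw [← h.direction_eq, ← h'.direction_eq])
    (by rw [← h.unitNormal_eq, ← h'.unitNormal_eq])

theorem not_collinear (h : IsFrame A p q r) :
    ¬ Collinear ℝ ({p, q, r} : Set (EuclideanSpace ℝ (Fin 3))) := by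
  obtain ⟨x, s, t, hx, hs, h1, h2⟩ := h
  rw [collinear_iff_of_mem (p₀ := p) (by simp)]
  rintro ⟨v, hv⟩
  simp only [Set.mem_insert_iff, Set.mem_singleton_iff, forall_eq_or_imp, forall_eq,
    vadd_eq_add] at hv
  obtain ⟨-, ⟨a, ha⟩, ⟨b, hb⟩⟩ := hv
  have h3 : q - p = a • v := by rw [ha]; simp
  have h4 : r - p = b • v := by rw [hb]; simp
  have h5 := cross_combination A x t s
  rw [← h1, ← h2, h3, h4] at h5
  have h6 : cross (a • v) (b • v) = 0 := by
    refine ext_three ?_ ?_ ?_ <;>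
      simp only [cross_apply_zero, cross_apply_one, cross_apply_two, PiLp.smul_apply,
        smul_eq_mul, PiLp.zero_apply] <;> ring
  rw [h6] at h5
  have h7 := congrArg norm h5
  rw [norm_smul, A.norm_col, norm_zero, mul_one, eq_comm, norm_eq_zero] at h7
  exact (mul_pos hx hs).ne' h7

theorem dist_lt (h : IsFrame A p q r) : 0 < dist p q + dist q r - dist r p := by
  have h1 : dist p q + dist q r ≠ dist r p := fun h0 => by
    rw [dist_comm r p, dist_add_dist_eq_iff] at h0
    exact h.not_collinear h0.collinear
  have h2 := dist_triangle p q r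
  rw [dist_comm p r] at h2
  exact sub_pos.2 (lt_of_le_of_ne h2 h1.symm)

/-- The frame of a triangle turns by the exterior angle when passing to the next edge. -/
theorem rotate (h : IsFrame A p q r) :
    IsFrame (A * SO3.rot₂ (Real.pi - lawAngle (dist q r) (dist r p) (dist p q))) q r p := by
  obtain ⟨x, s, t, hx, hs, h1, h2⟩ := h
  have h3 : r - q = (t - x) • A.col 0 + s • A.col 1 := by
    rw [← sub_sub_sub_cancel_right r q p, h1, h2]
    module
  have hdx : dist p q = x := by
    rw [dist_comm, dist_eq_norm, h1, norm_smul, A.norm_col, Real.norm_of_nonneg hx.le, mul_one]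
  have hdw : dist r p ^ 2 = t ^ 2 + s ^ 2 := by rw [dist_eq_norm, h2, norm_combination]
  have hdy : dist q r ^ 2 = (t - x) ^ 2 + s ^ 2 := by
    rw [dist_comm, dist_eq_norm, h3, norm_combination]
  have hy : 0 < dist q r := by
    refine lt_of_le_of_ne dist_nonneg fun h0 => ?_
    rw [← h0] at hdy
    nlinarith [sq_nonneg (t - x), mul_pos hs hs]
  set y := dist q r
  -- Since `r - q` has coordinates `t - x, s` in the frame, the angle at `q` has cosine `(x - t) /
  -- y` and sine `s / y`.
  have hq : (y ^ 2 + x ^ 2 - dist r p ^ 2) / (2 * y * x) = (x - t) / y := by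
    rw [hdw, hdy]
    field_simp
    ring
  have hsq : (x - t) ^ 2 ≤ y ^ 2 := by nlinarith [sq_nonneg s]
  have hcos : Real.cos (lawAngle y (dist r p) x) = (x - t) / y := by
    have := abs_le.1 (abs_le_of_sq_le_sq hsq hy.le)
    rw [lawAngle, hq, Real.cos_arccos]
    · rw [le_div_iff₀ hy]; linarith
    · rw [div_le_one hy]; linarith
  have hsin : Real.sin (lawAngle y (dist r p) x) = s / y := by
    rw [lawAngle, hq, Real.sin_arccos]
    refine (Real.sqrt_eq_iff_mul_self_eq_of_pos (div_pos hs hy)).2 ?_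
    field_simp
    linarith
  rw [hdx]
  obtain ⟨c0, c1, -⟩ := A.col_mul_rot₂ (Real.pi - lawAngle y (dist r p) x)
  rw [Real.cos_pi_sub, Real.sin_pi_sub, hcos, hsin] at c0 c1
  -- In the turned frame `p - q` has length `x` and makes the interior angle at `q` with the zeroth
  -- vector.
  refine ⟨y, x * (s / y), x * ((x - t) / y), hy, by positivity, ?_, ?_⟩
  · rw [h3, c0]
    match_scalars <;> field_simp
    ring
  · rw [← neg_sub q p, h1, c0, c1]
    match_scalars <;> field_simp <;> linarith

/-- The dihedral angle describes the transition between the frames at the two sides of an edge. -/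
theorem dihedralAngle_eq {s : EuclideanSpace ℝ (Fin 3)} {φ : ℝ} (h : IsFrame A p q r)
    (h' : IsFrame (A * SO3.edgeTransition φ) q p s) :
    (dihedralAngle p q r s : Real.Angle) = φ := by
  have hc : cross (Real.sin φ • A.col 1 + Real.cos φ • A.col 2) (A.col 2) =
      Real.sin φ • A.col 0 := by
    rw [← A.cross_col.2.1]
    refine ext_three ?_ ?_ ?_ <;>
      simp only [cross_apply_zero, cross_apply_one, cross_apply_two, PiLp.add_apply,
        PiLp.smul_apply, smul_eq_mul] <;> ring
  have hz : (⟨Real.cos φ, Real.sin φ⟩ : ℂ) =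
      (Real.cos φ : ℂ) + (Real.sin φ : ℂ) * Complex.I := Complex.mk_eq_add_mul_I _ _
  rw [dihedralAngle, h.unitNormal_eq, h'.unitNormal_eq, h.direction_eq,
    (A.col_mul_edgeTransition φ).2.2, hc]
  simp only [inner_add_left, inner_smul_left, inner_smul_right, A.inner_col]
  simp only [Fin.reduceEq, if_true, if_false]
  simp only [mul_zero, mul_one, zero_add, Real.ringHom_apply]
  rw [hz]
  simpa only [Real.Angle.cos_coe, Real.Angle.sin_coe] using
    Complex.arg_cos_add_sin_mul_I_coe_angle (φ : Real.Angle)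

/-- The two frames have opposite edge directions, so they differ by an edge transition;
`dihedralAngle_eq` identifies its angle modulo 2π, which is all that the rotation sees. -/
theorem edgeTransition_dihedralAngle {s : EuclideanSpace ℝ (Fin 3)} (h : IsFrame A p q r) {B : SO3}
    (h' : IsFrame B q p s) : B = A * SO3.edgeTransition (dihedralAngle p q r s) := by
  have h0 : B.col 0 = -A.col 0 := by
    rw [← h.direction_eq, ← h'.direction_eq, norm_sub_rev, ← smul_neg, neg_sub]
  obtain ⟨φ, rfl⟩ := SO3.exists_eq_mul_edgeTransition h0
  rw [SO3.edgeTransition, SO3.edgeTransition, SO3.rot₀_congr (h.dihedralAngle_eq h')]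

end IsFrame

end NRICGeometry

/-! ### Necessity and sufficiency of the integrability conditions -/

/-- One step around a vertex goes back to the preceding edge of the face and then crosses that edge.
The half turns cancel, which leaves the factors of I_v. -/
theorem NRICGeometry.SO3.rot₂_inv_mul_edgeTransition (γ θ : ℝ) :
    (SO3.rot₂ (Real.pi - γ))⁻¹ * SO3.edgeTransition θ = SO3.rot₂ γ * SO3.rot₀ θ := by
  rw [SO3.rot₂_inv, SO3.edgeTransition, ← mul_assoc, SO3.rot₂_mul]
  congr 2
  ring

namespace SimplicialSurface

variable {V : Type*} [Fintype V] [DecidableEq V] {K : SimplicialSurface V}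

open scoped Classical in
/-- The value of a function on the edges at the edge with given endpoints. -/
noncomputable def onEdge (f : K.Edge → ℝ) (a b : V) : ℝ :=
  if h : ({a, b} : Finset V) ∈ K.faces ∧ ({a, b} : Finset V).card = 2 then f ⟨{a, b}, h⟩ else 0

theorem apply_eq_onEdge (f : K.Edge → ℝ) {e : K.Edge} {a b : V} (h : e.1 = {a, b}) :
    f e = onEdge f a b := by
  obtain ⟨s, hs⟩ := e
  dsimp only at h
  subst h
  rw [onEdge, dif_pos hs]

theorem onEdge_comm (f : K.Edge → ℝ) (a b : V) : onEdge f a b = onEdge f b a := by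
  by_cases h : ({a, b} : Finset V) ∈ K.faces ∧ ({a, b} : Finset V).card = 2
  · rw [← apply_eq_onEdge f (e := ⟨_, h⟩) rfl,
      ← apply_eq_onEdge f (e := ⟨_, h⟩) (Finset.pair_comm a b)]
  · have h' := h
    rw [Finset.pair_comm a b] at h'
    rw [onEdge, onEdge, dif_neg h, dif_neg h']

namespace Orientation

variable {o : K.Orientation}

theorem interiorAngle_eq (z : K.NRIC) {v a b : V} (h : o.pos v a b) :
    o.interiorAngle z h = lawAngle (onEdge z.1 v a) (onEdge z.1 a b) (onEdge z.1 b v) := by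
  rw [← apply_eq_onEdge z.1 (e := o.edge h) rfl,
    ← apply_eq_onEdge z.1 (e := o.edge (o.rotate h)) rfl,
    ← apply_eq_onEdge z.1 (e := o.edge (o.rotate (o.rotate h))) rfl]
  rfl

theorem triangleMap_pos_iff (z : K.NRIC) : (∀ t, 0 < o.triangleMap z t) ↔ ∀ {a b c}, o.pos a b c →
    0 < onEdge z.1 a b + onEdge z.1 b c - onEdge z.1 c a := by
  have key : ∀ {a b c} (h : o.pos a b c), o.triangleMap z ⟨(a, b, c), h⟩ =
      onEdge z.1 a b + onEdge z.1 b c - onEdge z.1 c a := fun {a b c} h => by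
    rw [← apply_eq_onEdge z.1 (e := o.edge h) rfl,
    ← apply_eq_onEdge z.1 (e := o.edge (o.rotate h)) rfl,
      ← apply_eq_onEdge z.1 (e := o.edge (o.rotate (o.rotate h))) rfl]
    rfl
  refine ⟨fun H a b c h => key h ▸ H ⟨(a, b, c), h⟩, fun H t => ?_⟩
  obtain ⟨⟨a, b, c⟩, h⟩ := t
  rw [key h]
  exact H h

theorem VertexLoop.rotProd_eq_one_iff {v : V} (L : o.VertexLoop v) (z : K.NRIC) :
    L.rotProd z = 1 ↔ ∃ P : Fin L.n → SO3, ∀ i, P (finRotate _ i) = P i *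
      (SO3.rot₀ (onEdge z.2 v (L.nbr i)) * SO3.rot₂ (o.interiorAngle z (L.pos i))) := by
  rw [← List.prod_ofFn_eq_one_iff_exists_finRotate]
  have h : L.rotProd z = ((List.ofFn fun i => SO3.rot₀ (onEdge z.2 v (L.nbr i)) *
      SO3.rot₂ (o.interiorAngle z (L.pos i))).prod : SO3) := by
    rw [rotProd, Submonoid.coe_list_prod, List.map_ofFn]
    congr 2
    funext i
    rw [apply_eq_onEdge z.2 (e := o.edge (L.pos i)) rfl]
    rfl
  rw [h]
  exact ⟨fun h => Subtype.ext h, fun h => congrArg Subtype.val h⟩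

theorem VertexLoop.vec_quatProd_eq_zero_iff {v : V} (L : o.VertexLoop v) (z : K.NRIC) :
    vec (L.quatProd z) = 0 ↔ L.rotProd z = 1 := by
  rw [vec_eq_zero_iff_quatRotation (L.normSq_quatProd z), L.quatRotation_quatProd]

/-- A map is generic if and only if every face has a frame. -/
theorem isGeneric_iff (X : V → EuclideanSpace ℝ (Fin 3)) : K.IsGeneric X ↔
    ∀ {a b c}, o.pos a b c → ∃ A, IsFrame A (X a) (X b) (X c) := by
  have himage : ∀ a b c, X '' (({a, b, c} : Finset V) : Set V) = {X a, X b, X c} := fun a b c => by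
    simp [Set.image_insert_eq]
  constructor
  · intro hX a b c h
    have := hX _ (o.face_of_pos h).1 (o.face_of_pos h).2
    rw [himage] at this
    exact exists_isFrame this
  · intro H s hs h3
    obtain ⟨a, b, c, hab, hac, hbc, rfl⟩ := Finset.card_eq_three.1 h3
    rcases o.pos_or_pos hs (a := a) (b := b) (c := c) (by simp) (by simp) (by simp) hab hbc hac
      with h | h
    · obtain ⟨A, hA⟩ := H h
      rw [himage]
      exact hA.not_collinear
    · obtain ⟨A, hA⟩ := H h
      rw [himage, Set.insert_comm]
      exact hA.not_collinear

/-- Every edge lies in a face, so some direction of it is positive; lengths need checking only along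
positive directions. -/
theorem isRealizedBy_iff (z : K.NRIC) (X : V → EuclideanSpace ℝ (Fin 3)) :
    o.IsRealizedBy z X ↔ (∀ {a b c}, o.pos a b c → onEdge z.1 a b = dist (X a) (X b)) ∧
      ∀ {a b c d}, o.pos a b c → o.pos b a d →
        (onEdge z.2 a b : Real.Angle) = dihedralAngle (X a) (X b) (X c) (X d) := by
  constructor
  · rintro ⟨h1, h2⟩
    refine ⟨fun {a b c} h => ?_, fun {a b c d} h h' => ?_⟩
    · rw [← apply_eq_onEdge z.1 (e := o.edge h) rfl]
      exact h1 _ _ _ rfl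
    · rw [← apply_eq_onEdge z.2 (e := o.edge h) rfl]
      exact h2 _ _ _ _ h h'
  · rintro ⟨h1, h2⟩
    refine ⟨fun e a b he => ?_, fun a b c d h h' => ?_⟩
    · have hab : a ≠ b := fun h => by
        have := e.2.2
        rw [he, h] at this
        simp at this
      have hf := e.2.1
      rw [he] at hf
      rw [apply_eq_onEdge z.1 he]
      obtain ⟨c, h | h⟩ := o.exists_pos hf (a := a) (b := b) (by simp) (by simp) hab
      · exact h1 h
      · rw [onEdge_comm, dist_comm]
        exact h1 h
    · rw [apply_eq_onEdge z.2 (e := o.edge h) rfl]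
      exact h2 h h'

/-- The lengths and dihedral angles of a generic map satisfy the triangle inequalities and the
integrability conditions. -/
theorem integrability_of_isRealizedBy {z : K.NRIC} {X : V → EuclideanSpace ℝ (Fin 3)}
    (hX : K.IsGeneric X) (hz : o.IsRealizedBy z X) :
    (∀ t, 0 < o.triangleMap z t) ∧ ∀ v (L : o.VertexLoop v), L.rotProd z = 1 := by
  rw [isGeneric_iff (o := o)] at hX
  obtain ⟨hl, hθ⟩ := (isRealizedBy_iff z X).1 hz
  refine ⟨(triangleMap_pos_iff z).2 fun {a b c} h => ?_, fun v L => ?_⟩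
  · obtain ⟨A, hA⟩ := hX h
    rw [hl h, hl (o.rotate h), hl (o.rotate (o.rotate h))]
    exact hA.dist_lt
  · rw [L.rotProd_eq_one_iff]
    choose A hA using fun i => hX (L.pos i)
    -- The step between the frames `A i` is R₂(γ) R₀(θ), with the factors in the other order;
    -- undoing the rotation by θ shifts the starting point to match I_v.
    refine ⟨fun i => A i * (SO3.rot₀ (onEdge z.2 v (L.nbr i)))⁻¹, fun i => ?_⟩
    have h := L.pos i
    have h' := o.rotate (o.rotate h)
    obtain ⟨B, hB⟩ := hX h'
    have e1 := (hA i).eq hB.rotate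
    have e2 := hB.edgeTransition_dihedralAngle (hA (finRotate _ i))
    have e3 := SO3.rot₀_congr (hθ h' (L.pos (finRotate _ i)))
    rw [SO3.edgeTransition, ← e3, ← SO3.edgeTransition] at e2
    have e4 : A (finRotate _ i) = A i * ((SO3.rot₂ (Real.pi - o.interiorAngle z h))⁻¹ *
        SO3.edgeTransition (onEdge z.2 (L.nbr (finRotate _ i)) v)) := by
      rw [e2, e1, interiorAngle_eq, hl h, hl (o.rotate h), hl h']
      group
    dsimp only
    rw [e4, SO3.rot₂_inv_mul_edgeTransition, onEdge_comm]
    group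

/-- On a simply connected surface, lengths and angles that satisfy the triangle inequalities and the
integrability conditions are those of a generic map. -/
theorem exists_isRealizedBy (hK : SimplyConnectedSpace K.toAbstractSimplicialComplex.realization)
    {z : K.NRIC} (hT : ∀ t, 0 < o.triangleMap z t)
    (hI : ∀ v, Nonempty (o.VertexLoop v) → ∃ L : o.VertexLoop v, L.rotProd z = 1) :
    ∃ X, K.IsGeneric X ∧ o.IsRealizedBy z X := by
  rw [triangleMap_pos_iff] at hT
  set l := onEdge z.1
  set θ := onEdge z.2
  let ρ : V → V → V → SO3 := fun a b c =>
    SO3.rot₂ (Real.pi - lawAngle (l b c) (l c a) (l a b))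
  have hρ : ∀ {a b c}, o.pos a b c → ρ a b c * ρ b c a * ρ c a b = 1 := fun {a b c} h => by
    simp only [ρ, SO3.rot₂_mul]
    exact SO3.rot₂_eq_one (cos_sum_exterior (hT h) (hT (o.rotate h)) (hT (o.rotate (o.rotate h))))
  obtain ⟨F, hF⟩ := o.exists_frames hK ρ (fun a b => SO3.edgeTransition (θ a b)) hρ
    (fun {a b c d} _ _ => by rw [show θ b a = θ a b from onEdge_comm _ _ _,
      SO3.edgeTransition_mul_self]) (fun v hv => by
    obtain ⟨L, hL⟩ := hI v hv
    obtain ⟨P, hP⟩ := (L.rotProd_eq_one_iff z).1 hL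
    refine ⟨L, fun i => P i * SO3.rot₀ (θ v (L.nbr i)), fun i => ?_⟩
    dsimp only
    rw [SO3.rot₂_inv_mul_edgeTransition, hP, interiorAngle_eq,
      show θ (L.nbr (finRotate _ i)) v = θ v (L.nbr (finRotate _ i)) from onEdge_comm _ _ _]
    simp only [mul_assoc]
    rfl)
  have hcol : ∀ {a b c}, o.pos a b c → (F b c).col 0 =
      -Real.cos (lawAngle (l b c) (l c a) (l a b)) • (F a b).col 0 +
        Real.sin (lawAngle (l b c) (l c a) (l a b)) • (F a b).col 1 := fun {a b c} h => by
    rw [(hF h).1, ((F a b).col_mul_rot₂ _).1, Real.cos_pi_sub, Real.sin_pi_sub]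
  have hcol' : ∀ {a b c}, o.pos a b c → (F c a).col 0 =
      -Real.cos (lawAngle (l a b) (l b c) (l c a)) • (F a b).col 0 -
        Real.sin (lawAngle (l a b) (l b c) (l c a)) • (F a b).col 1 := fun {a b c} h => by
    have h1 : F c a = F a b * (ρ c a b)⁻¹ := by
      rw [(hF (o.rotate (o.rotate h))).1, mul_inv_cancel_right]
    rw [h1, SO3.rot₂_inv, ((F a b).col_mul_rot₂ _).1, Real.cos_neg, Real.sin_neg, Real.cos_pi_sub,
      Real.sin_pi_sub, neg_smul (Real.sin _), sub_eq_add_neg]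
  have h₃ : ∀ {a b c}, o.pos a b c →
      l a b • (F a b).col 0 + l b c • (F b c).col 0 + l c a • (F c a).col 0 = 0 :=
    fun {a b c} h => by
      obtain ⟨e1, e2⟩ := side_eq (hT h) (hT (o.rotate h)) (hT (o.rotate (o.rotate h)))
      rw [hcol h, hcol' h]
      match_scalars
      · linear_combination e1
      · linear_combination e2
  have h₂ : ∀ {a b c d}, o.pos a b c → o.pos b a d →
      l a b • (F a b).col 0 + l b a • (F b a).col 0 = 0 := fun {a b c d} h h' => by
    rw [(hF h).2 h', ((F a b).col_mul_edgeTransition _).1,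
      show l b a = l a b from onEdge_comm _ _ _, smul_neg, add_neg_cancel]
  -- Second integration: the edge vectors are an additive cocycle, whose potential is the position
  -- of the vertices.
  obtain ⟨h, hh⟩ := o.exists_potential hK
    (fun a b => Multiplicative.ofAdd (l a b • (F a b).col 0)) h₃ h₂
  let X : V → EuclideanSpace ℝ (Fin 3) := fun a => (h a).toAdd
  have hX : ∀ {a b c}, o.pos a b c → X b - X a = l a b • (F a b).col 0 := fun {a b c} hp =>
    sub_eq_iff_eq_add'.2 (hh hp)
  have hlpos : ∀ {a b c}, o.pos a b c → 0 < l a b := fun {a b c} hp => by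
    linarith [hT hp, hT (o.rotate (o.rotate hp))]
  have hframe : ∀ {a b c}, o.pos a b c → IsFrame (F a b) (X a) (X b) (X c) := fun {a b c} hp => by
    -- The coordinates of `X c - X a` come from adding the edge vectors `a b` and `b c`, the latter
    -- turned by the exterior angle at `b`.
    refine ⟨l a b, l b c * Real.sin (lawAngle (l b c) (l c a) (l a b)),
      l a b - l b c * Real.cos (lawAngle (l b c) (l c a) (l a b)), hlpos hp,
      mul_pos (hlpos (o.rotate hp)) (sin_lawAngle_pos (hT (o.rotate hp))
        (hT (o.rotate (o.rotate hp))) (hT hp)), hX hp, ?_⟩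
    rw [← sub_add_sub_cancel (X c) (X b) (X a), hX hp, hX (o.rotate hp), hcol hp]
    module
  refine ⟨X, (isGeneric_iff (o := o) X).2 fun hp => ⟨_, hframe hp⟩, (isRealizedBy_iff z X).2
    ⟨fun {a b c} hp => ?_, fun {a b c d} hp hq => ?_⟩⟩
  · rw [dist_comm, dist_eq_norm, hX hp, norm_smul, SO3.norm_col, mul_one,
      Real.norm_of_nonneg (hlpos hp).le]
  · have h1 := hframe hq
    rw [(hF hp).2 hq] at h1
    exact ((hframe hp).dihedralAngle_eq h1).symm

end Orientation

end SimplicialSurface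

theorem mainTheorem1 {V : Type*} [Fintype V] [DecidableEq V] (K : SimplicialSurface V)
    (hK : SimplyConnectedSpace K.toAbstractSimplicialComplex.realization)
    (o : K.Orientation) (L : ∀ v : o.InteriorVertex, o.VertexLoop v.1) :
    o.nricManifold = {z : K.NRIC | (∀ t, 0 < o.triangleMap z t) ∧ o.quatMap L z = 0} ∧
    ∀ (z : K.NRIC) (v : o.InteriorVertex),
      (o.quatMap L z v = 0 ↔ (L v).quatProd z = 1 ∨ (L v).quatProd z = -1) ∧
      (o.quatMap L z v = 0 ↔ (L v).rotProd z = 1) := by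
  refine ⟨Set.ext fun z => ?_, fun z v => ⟨vec_eq_zero_iff_eq_one_or ((L v).normSq_quatProd z),
    (L v).vec_quatProd_eq_zero_iff z⟩⟩
  constructor
  · rintro ⟨X, hX, hz⟩
    obtain ⟨hT, hI⟩ := SimplicialSurface.Orientation.integrability_of_isRealizedBy hX hz
    exact ⟨hT, funext fun v => ((L v).vec_quatProd_eq_zero_iff z).2 (hI _ _)⟩
  · rintro ⟨hT, hQ⟩
    exact SimplicialSurface.Orientation.exists_isRealizedBy hK hT fun v hv =>
      ⟨L ⟨v, hv⟩, ((L ⟨v, hv⟩).vec_quatProd_eq_zero_iff z).1 (congrFun hQ ⟨v, hv⟩)⟩
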